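/- Let $\nu>0$, and let $\lambda$ denote Lebesgue measure on $\mathbb{C}$ and on $\mathbb{C}^2$. Let $L^{2,\nu}(\mathbb{C})=L^2(\mathbb{C},e^{-\nu|\xi|^2}d\lambda(\xi))$, and let $\mathcal{F}^{2,\nu}(\mathbb{C}^2)$ be the Bargmann–Fock space of all holomorphic functions on $\mathbb{C}^2$ that are square integrable with respect to $e^{-\nu(|z|^2+|w|^2)}d\lambda(z,w)$, with the $L^2$-norm of that measure. For $m,n\ge 0$ let $$H^\nu_{m,n}(\xi,\bar\xi)=(-1)^{m+n}e^{\nu\xi\bar\xi}\frac{\partial^{m+n}}{\partial\bar\xi^m\,\partial\xi^n}\left(e^{-\nu\xi\bar\xi}\right)$$ be the univariate complex Hermite polynomials. Consider the integral operator $$\mathcal{T}^\nu\psi(z,w)=\left(\frac{\nu}{\pi}\right)^{3/2}\int_{\mathbb{C}}e^{-\nu(z-\xi)(w-\bar\xi)}\psi(\xi)\,d\lambda(\xi).$$ (1) For every $\psi\in L^{2,\nu}(\mathbb{C})$ the integral converges absolutely for all $z,w\in\mathbb{C}$, and $\mathcal{T}^\nu$ is a (linear, surjective) isometric isomorphism from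 $L^{2,\nu}(\mathbb{C})$ onto $\mathcal{F}^{2,\nu}(\mathbb{C}^2)$. (2) Its inverse is given by $$(\mathcal{T}^\nu)^{-1}\varphi(\xi)=\left(\frac{\nu}{\pi}\right)^{3/2}\int_{\mathbb{C}^2}e^{-\nu(|z|^2+|w|^2)+\nu(\bar z\xi+\bar w\bar\xi-\bar z\bar w)}\varphi(z,w)\,d\lambda(z,w),$$ in the following sense, for every $\varphi\in\mathcal{F}^{2,\nu}(\mathbb{C}^2)$. For every $R$, the same integral taken over the ball $\{|z|^2+|w|^2<R^2\}$ converges absolutely for every $\xi$ and defines a function of $\xi$ in $L^{2,\nu}(\mathbb{C})$; as $R\to\infty$ these functions converge to $(\mathcal{T}^\nu)^{-1}\varphi$ in $L^{2,\nu}(\mathbb{C})$. Moreover, for almost every $\xi\in\mathbb{C}$: if the integral over $\mathbb{C}^2$ converges absolutely at $\xi$, then the displayed formula holds at $\xi$. (3) For all integers $m,n\ge0$ and all $z,w\in\mathbb{C}$, the following integral converges absolutely and $$\int_{\mathbb{C}}e^{-\nu(z-\xi)(w-\bar\xi)}H^\nu_{m,n}(\xi,\bar\xi)\,d\lambda(\xi)=\left(\frac{\pi}{\nu}\right)\nu^{m+n}z^mw^n.$$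 -/

import Mathlib

open MeasureTheory Filter Topology

noncomputable section

namespace BargmannFock

/-- The Gaussian measure `exp (-ν |ξ|²) dλ(ξ)` on `ℂ` (`λ` is Lebesgue measure). -/
def gaussC (ν : ℝ) : Measure ℂ :=
  volume.withDensity fun ξ => ENNReal.ofReal (Real.exp (-ν * ‖ξ‖ ^ 2))

/-- The Gaussian measure `exp (-ν (|z|² + |w|²)) dλ(z, w)` on `ℂ²`. -/
def gaussC2 (ν : ℝ) : Measure (ℂ × ℂ) :=
  volume.withDensity fun p => ENNReal.ofReal (Real.exp (-ν * (‖p.1‖ ^ 2 + ‖p.2‖ ^ 2)))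

/-- The Hilbert space `L^{2,ν}(ℂ)`. -/
abbrev L2C (ν : ℝ) : Type := Lp ℂ 2 (gaussC ν)

/-- The vector space of holomorphic functions on `ℂ²` that are square integrable for the
Gaussian measure. -/
def fockSubmodule (ν : ℝ) : Submodule ℂ (ℂ × ℂ → ℂ) where
  carrier := {φ | Differentiable ℂ φ ∧ MemLp φ 2 (gaussC2 ν)}
  add_mem' := fun ha hb => ⟨ha.1.add hb.1, ha.2.add hb.2⟩
  zero_mem' := ⟨differentiable_const (0 : ℂ), MemLp.zero⟩
  smul_mem' := fun c _ ha => ⟨ha.1.const_smul c, ha.2.const_smul c⟩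

/-- The Bargmann–Fock space `𝓕^{2,ν}(ℂ²)`; its elements are functions, its norm is that of
`L^{2,ν}(ℂ²)` (see the instances below). -/
def FockSpace (ν : ℝ) : Type := fockSubmodule ν

instance (ν : ℝ) : AddCommGroup (FockSpace ν) := inferInstanceAs (AddCommGroup (fockSubmodule ν))

instance (ν : ℝ) : Module ℂ (FockSpace ν) := inferInstanceAs (Module ℂ (fockSubmodule ν))

instance (ν : ℝ) : CoeFun (FockSpace ν) fun _ => ℂ × ℂ → ℂ := ⟨fun φ => φ.1⟩

/-- The canonical map from the Bargmann–Fock space to `L^{2,ν}(ℂ²)`. -/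
def FockSpace.toL2 (ν : ℝ) : FockSpace ν →ₗ[ℂ] Lp ℂ 2 (gaussC2 ν) where
  toFun φ := φ.2.2.toLp φ.1
  map_add' φ χ := MemLp.toLp_add φ.2.2 χ.2.2
  map_smul' c φ := MemLp.toLp_const_smul c φ.2.2

theorem FockSpace.toL2_injective (ν : ℝ) : Function.Injective (FockSpace.toL2 ν) := by
  intro φ χ h
  have h1 : φ.1 =ᵐ[gaussC2 ν] χ.1 := (MemLp.toLp_eq_toLp_iff φ.2.2 χ.2.2).1 h
  have hac : (volume : Measure (ℂ × ℂ)) ≪ gaussC2 ν := by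
    refine withDensity_absolutelyContinuous' ?_ ?_
    · refine Measurable.aemeasurable ?_
      fun_prop
    · refine Eventually.of_forall fun p => ?_
      simp [Real.exp_pos]
  exact Subtype.ext
    (Continuous.ae_eq_iff_eq volume φ.2.1.continuous χ.2.1.continuous |>.1 (hac.ae_le h1))

instance (ν : ℝ) : NormedAddCommGroup (FockSpace ν) :=
  NormedAddCommGroup.induced _ _ (FockSpace.toL2 ν) (FockSpace.toL2_injective ν)

instance (ν : ℝ) : NormedSpace ℂ (FockSpace ν) :=
  NormedSpace.induced ℂ _ _ (FockSpace.toL2 ν)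

/-- The integral kernel `exp (-ν (z - ξ) (w - ξ̄))`. -/
def kernelT (ν : ℝ) (z w ξ : ℂ) : ℂ :=
  Complex.exp (-(ν : ℂ) * (z - ξ) * (w - star ξ))

/-- The transform
`𝓣^ν ψ (z, w) = (ν/π)^{3/2} ∫ exp (-ν (z - ξ) (w - ξ̄)) ψ(ξ) dλ(ξ)`. -/
def transformT (ν : ℝ) (ψ : ℂ → ℂ) (z w : ℂ) : ℂ :=
  (((ν / Real.pi) ^ (3 / 2 : ℝ) : ℝ) : ℂ) * ∫ ξ : ℂ, kernelT ν z w ξ * ψ ξ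

/-- The kernel `exp (-ν (|z|² + |w|²) + ν (z̄ ξ + w̄ ξ̄ - z̄ w̄))` at `p = (z, w)`. -/
def kernelInv (ν : ℝ) (ξ : ℂ) (p : ℂ × ℂ) : ℂ :=
  Complex.exp (-(ν : ℂ) * ((‖p.1‖ : ℂ) ^ 2 + (‖p.2‖ : ℂ) ^ 2)
    + (ν : ℂ) * (star p.1 * ξ + star p.2 * star ξ - star p.1 * star p.2))

/-- The inversion integral taken over a set `K ⊆ ℂ²`:
`(ν/π)^{3/2} ∫_K exp (-ν (|z|² + |w|²) + ν (z̄ ξ + w̄ ξ̄ - z̄ w̄)) φ(z, w) dλ(z, w)`. -/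
def inverseIntegral (ν : ℝ) (K : Set (ℂ × ℂ)) (φ : ℂ × ℂ → ℂ) (ξ : ℂ) : ℂ :=
  (((ν / Real.pi) ^ (3 / 2 : ℝ) : ℝ) : ℂ) * ∫ p in K, kernelInv ν ξ p * φ p

/-- The open Euclidean ball `|z|² + |w|² < R²` of `ℂ²` (the norm of the type `ℂ × ℂ` is the
maximum norm). -/
def ballC2 (R : ℝ) : Set (ℂ × ℂ) := {p | ‖p.1‖ ^ 2 + ‖p.2‖ ^ 2 < R ^ 2}

/-- The Wirtinger derivative `∂/∂z = (∂/∂x - i ∂/∂y) / 2`. -/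
def wirtinger (f : ℂ → ℂ) (ζ : ℂ) : ℂ :=
  (fderiv ℝ f ζ 1 - Complex.I * fderiv ℝ f ζ Complex.I) / 2

/-- The Wirtinger derivative `∂/∂z̄ = (∂/∂x + i ∂/∂y) / 2`. -/
def wirtingerBar (f : ℂ → ℂ) (ζ : ℂ) : ℂ :=
  (fderiv ℝ f ζ 1 + Complex.I * fderiv ℝ f ζ Complex.I) / 2

/-- The univariate complex Hermite polynomial
`H^ν_{m,n}(ζ, ζ̄) = (-1)^{m+n} e^{ν ζ ζ̄} ∂^{m+n}/∂ζ̄^m ∂ζ^n (e^{-ν ζ ζ̄})`. -/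
def hermite (ν : ℝ) (m n : ℕ) (ζ : ℂ) : ℂ :=
  (-1) ^ (m + n) * Complex.exp ((ν : ℂ) * ζ * star ζ) *
    (wirtingerBar^[m] (wirtinger^[n] fun z : ℂ => Complex.exp (-(ν : ℂ) * z * star z))) ζ

end BargmannFock

end

/-!
For `p = (z, w)` put `q_p(ξ) = (ν/π)^{3/2} conj (exp (ν (z ξ̄ + w ξ - z w)))`, the vector `kernelVec`
of `L^{2,ν}(ℂ)`. Then `𝓣^ν ψ (p) = ⟪q_p, ψ⟫`. A Gaussian integral (`inner_kernelVec_kernelVec`) shows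
that `⟪q_a, q_b⟫ = K_b(a)`, where `K_b(a) = (ν/π)² exp (ν (b̄₁ a₁ + b̄₂ a₂))` is the reproducing kernel
of the Bargmann–Fock space (`inner_toL2_fockKernelVec`). So `q_a ↦ K_a` preserves inner products.
The `q_a` are total, by injectivity of the Fourier transform (`eq_zero_of_inner_kernelVec`), so this
map extends to an isometry `S` of `L^{2,ν}(ℂ)` into `L^{2,ν}(ℂ²)`, and `S ψ` is represented by the
entire function `𝓣^ν ψ` (`coeFn_transformL2`, `differentiable_integral_entireKernel_mul`).
For `φ` in the Bargmann–Fock space, `⟪q_a, S* φ⟫ = ⟪K_a, φ⟫ = φ(a)`; hence `𝓣^ν` is onto, with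
inverse `S*` (`transformFock_adjoint`).

Both the Gaussian integral and the reproducing property in two variables come from the
reproducing property in one variable, `integral_exp_mul_conj_gaussC`: the mean value property of
entire functions with respect to the rotation invariant Gaussian measure, translated.

By Fubini, `S*` is the inversion integral on functions supported in a ball
(`toLp_inverseIntegral_ballC2`). As `1_{B_R} φ → φ` in `L²`, these integrals converge to `S* φ`
in `L²`, and along a subsequence almost everywhere; dominated convergence then gives the formula
wherever the full integral converges absolutely.

For the Hermite polynomials, integration by parts moves the Wirtinger derivatives from
`exp (-ν |ξ|²)` to `exp (ν (z ξ̄ + w ξ))`, which is an eigenfunction of both derivatives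
(`integral_entireKernel_mul_wirtinger`).
-/

noncomputable section

namespace BargmannFock

open ComplexConjugate

/-! ### Gaussian measures and the mean value property -/

theorem integrable_gaussC_iff (ν : ℝ) (f : ℂ → ℂ) :
    Integrable f (gaussC ν) ↔
      Integrable (fun ξ => Complex.exp (-ν * (‖ξ‖ : ℂ) ^ 2) * f ξ) := by
  rw [gaussC, integrable_withDensity_iff_integrable_smul' (by fun_prop) (by simp)]
  refine integrable_congr (Eventually.of_forall fun ξ => ?_)
  simp [ENNReal.toReal_ofReal (Real.exp_pos _).le]

theorem integral_gaussC (ν : ℝ) (f : ℂ → ℂ) :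
    ∫ ξ, f ξ ∂gaussC ν = ∫ ξ, Complex.exp (-ν * (‖ξ‖ : ℂ) ^ 2) * f ξ := by
  rw [gaussC, integral_withDensity_eq_integral_toReal_smul (by fun_prop) (by simp)]
  refine integral_congr_ae (Eventually.of_forall fun ξ => ?_)
  simp [ENNReal.toReal_ofReal (Real.exp_pos _).le]

theorem volume_absolutelyContinuous_gaussC (ν : ℝ) : (volume : Measure ℂ) ≪ gaussC ν := by
  refine withDensity_absolutelyContinuous' (by fun_prop) (Eventually.of_forall fun p => ?_)
  simp [Real.exp_pos]

theorem integrable_gaussC2_iff (ν : ℝ) (f : ℂ × ℂ → ℂ) :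
    Integrable f (gaussC2 ν) ↔
      Integrable (fun p => Complex.exp (-ν * ((‖p.1‖ : ℂ) ^ 2 + (‖p.2‖ : ℂ) ^ 2)) * f p) := by
  rw [gaussC2, integrable_withDensity_iff_integrable_smul' (by fun_prop) (by simp)]
  refine integrable_congr (Eventually.of_forall fun ξ => ?_)
  simp [ENNReal.toReal_ofReal (Real.exp_pos _).le]

theorem integral_gaussC2 (ν : ℝ) (f : ℂ × ℂ → ℂ) :
    ∫ p, f p ∂gaussC2 ν =
      ∫ p, Complex.exp (-ν * ((‖p.1‖ : ℂ) ^ 2 + (‖p.2‖ : ℂ) ^ 2)) * f p := by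
  rw [gaussC2, integral_withDensity_eq_integral_toReal_smul (by fun_prop) (by simp)]
  refine integral_congr_ae (Eventually.of_forall fun ξ => ?_)
  simp [ENNReal.toReal_ofReal (Real.exp_pos _).le]

instance (ν : ℝ) : SFinite (gaussC ν) := by unfold gaussC; infer_instance

theorem gaussC2_eq_prod (ν : ℝ) : gaussC2 ν = (gaussC ν).prod (gaussC ν) := by
  rw [gaussC, prod_withDensity (by fun_prop) (by fun_prop), gaussC2]
  congr 1
  funext p
  rw [← ENNReal.ofReal_mul (Real.exp_pos _).le, ← Real.exp_add, mul_add]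

instance (ν : ℝ) : SFinite (gaussC2 ν) := by rw [gaussC2_eq_prod]; infer_instance

/-- Exponential growth is integrable for the Gaussian measure; all integrability in one variable is
reduced to this. -/
theorem integrable_exp_mul_norm {ν : ℝ} (hν : 0 < ν) (c : ℝ) :
    Integrable (fun ξ : ℂ => Real.exp (c * ‖ξ‖)) (gaussC ν) := by
  rw [gaussC, integrable_withDensity_iff_integrable_smul' (by fun_prop) (by simp)]
  have h := (GaussianFourier.integrable_cexp_neg_mul_sq_norm_add (V := ℂ) (b := (ν / 2 : ℝ))
    (by simpa using hν) 0 0).norm.const_mul (Real.exp (c ^ 2 / (2 * ν)))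
  refine h.mono' (by fun_prop) (Eventually.of_forall fun ξ => ?_)
  rw [ENNReal.toReal_ofReal (Real.exp_pos _).le, smul_eq_mul, ← Real.exp_add, Complex.norm_exp,
    ← Real.exp_add, Real.norm_eq_abs, abs_of_pos (Real.exp_pos _), Real.exp_le_exp]
  have e : (-((ν / 2 : ℝ) : ℂ) * (‖ξ‖ : ℂ) ^ 2 + 0 * ((inner ℝ (0 : ℂ) ξ : ℝ) : ℂ)).re =
      -(ν / 2) * ‖ξ‖ ^ 2 := by
    rw [zero_mul, add_zero]
    norm_cast
  rw [e]
  -- complete the square in `‖ξ‖`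
  have : c ^ 2 / (2 * ν) + -(ν / 2) * ‖ξ‖ ^ 2 - (-ν * ‖ξ‖ ^ 2 + c * ‖ξ‖) =
      (ν * ‖ξ‖ - c) ^ 2 / (2 * ν) := by
    field_simp
    ring
  have : 0 ≤ (ν * ‖ξ‖ - c) ^ 2 / (2 * ν) := by positivity
  linarith

theorem isFiniteMeasure_gaussC {ν : ℝ} (hν : 0 < ν) : IsFiniteMeasure (gaussC ν) := by
  have := integrable_exp_mul_norm hν 0
  simp only [zero_mul, Real.exp_zero] at this
  exact (integrable_const_iff_isFiniteMeasure one_ne_zero).1 this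

theorem isFiniteMeasure_gaussC2 {ν : ℝ} (hν : 0 < ν) : IsFiniteMeasure (gaussC2 ν) := by
  have := isFiniteMeasure_gaussC hν
  rw [gaussC2_eq_prod]
  infer_instance

theorem memLp_exp_mul_norm {ν : ℝ} (hν : 0 < ν) (c : ℝ) :
    MemLp (fun ξ : ℂ => Real.exp (c * ‖ξ‖)) 2 (gaussC ν) := by
  rw [memLp_two_iff_integrable_sq (by fun_prop)]
  refine (integrable_exp_mul_norm hν (2 * c)).congr (Eventually.of_forall fun ξ => ?_)
  simp only
  rw [← Real.exp_nat_mul]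
  push_cast
  ring_nf

theorem memLp_exp_mul_norm_mul {ν : ℝ} (hν : 0 < ν) (c d : ℝ) :
    MemLp (fun p : ℂ × ℂ => Real.exp (c * ‖p.1‖) * Real.exp (d * ‖p.2‖)) 2 (gaussC2 ν) := by
  rw [memLp_two_iff_integrable_sq (by fun_prop), gaussC2_eq_prod]
  refine ((integrable_exp_mul_norm hν (2 * c)).mul_prod
    (integrable_exp_mul_norm hν (2 * d))).congr (Eventually.of_forall fun ξ => ?_)
  simp only
  rw [mul_pow, ← Real.exp_nat_mul, ← Real.exp_nat_mul]
  push_cast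
  ring_nf

theorem integral_one_gaussC {ν : ℝ} (hν : 0 < ν) :
    ∫ _ : ℂ, (1 : ℂ) ∂gaussC ν = (Real.pi / ν : ℝ) := by
  rw [integral_gaussC]
  have := GaussianFourier.integral_cexp_neg_mul_sq_norm (V := ℂ) (b := (ν : ℂ)) (by simpa)
  simpa using this

theorem measurePreserving_circle_mul (ν : ℝ) (u : Circle) :
    MeasurePreserving (fun ξ : ℂ => u * ξ) (gaussC ν) (gaussC ν) := by
  have h : MeasurePreserving (fun ξ : ℂ => (u : ℂ) * ξ) volume volume :=
    (rotation u).measurePreserving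
  have he : MeasurableEmbedding (fun ξ : ℂ => (u : ℂ) * ξ) :=
    (rotation u).toHomeomorph.measurableEmbedding
  refine ⟨h.measurable, ?_⟩
  ext s hs
  rw [he.map_apply, gaussC, withDensity_apply _ hs, withDensity_apply _ (h.measurable hs),
    ← h.setLIntegral_comp_preimage_emb he _ s]
  simp [Circle.norm_coe]

/-- The mean value property of an entire function with respect to a Gaussian measure, obtained by
averaging over rotations. -/
theorem integral_gaussC_of_differentiable {ν : ℝ} (hν : 0 < ν) {f : ℂ → ℂ}
    (hf : Differentiable ℂ f) (hi : Integrable f (gaussC ν)) :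
    ∫ ξ, f ξ ∂gaussC ν = (Real.pi / ν : ℝ) * f 0 := by
  have hrot : ∀ θ : ℝ, MeasurePreserving (fun ξ : ℂ => circleMap 0 1 θ * ξ) (gaussC ν)
      (gaussC ν) := fun θ => by
    simpa [circleMap] using measurePreserving_circle_mul ν (Circle.exp θ)
  have hemb : ∀ θ : ℝ, MeasurableEmbedding (fun ξ : ℂ => circleMap 0 1 θ * ξ) := fun θ => by
    have : MeasurableEmbedding (fun ξ : ℂ => (Circle.exp θ : ℂ) * ξ) :=
      (rotation (Circle.exp θ)).toHomeomorph.measurableEmbedding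
    simpa [circleMap] using this
  have hcont := hf.continuous
  -- the circle average of `f` through `ξ` is `f 0`
  have havg : ∀ ξ : ℂ, ∫ θ in Set.Ioc 0 (2 * Real.pi), f (circleMap 0 1 θ * ξ) =
      2 * Real.pi * f 0 := by
    intro ξ
    have hg : Differentiable ℂ fun u : ℂ => f (u * ξ) := by fun_prop
    have := (hg.diffContOnCl (s := Metric.ball 0 |1|)).circleAverage
    rw [Real.circleAverage_def, zero_mul, inv_smul_eq_iff₀ (by positivity),
      intervalIntegral.integral_of_le (by positivity)] at this
    rw [this]
    simp
  have hint : Integrable (fun q : ℝ × ℂ => f (circleMap 0 1 q.1 * q.2))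
      ((volume.restrict (Set.Ioc 0 (2 * Real.pi))).prod (gaussC ν)) := by
    rw [integrable_prod_iff (by
      have : Continuous fun q : ℝ × ℂ => f (circleMap 0 1 q.1 * q.2) := by
        unfold circleMap; fun_prop
      exact this.aestronglyMeasurable)]
    refine ⟨Eventually.of_forall fun θ => (hrot θ).integrable_comp_of_integrable hi, ?_⟩
    have : ∀ θ, ∫ ξ, ‖f (circleMap 0 1 θ * ξ)‖ ∂gaussC ν = ∫ ξ, ‖f ξ‖ ∂gaussC ν := fun θ =>
      (hrot θ).integral_comp (hemb θ) fun ξ => ‖f ξ‖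
    simp only [this]
    exact integrable_const _
  have key := integral_integral_swap (f := fun (θ : ℝ) ξ => f (circleMap 0 1 θ * ξ)) hint
  have e : ∀ θ : ℝ, ∫ ξ, f (circleMap 0 1 θ * ξ) ∂gaussC ν = ∫ ξ, f ξ ∂gaussC ν := fun θ =>
    (hrot θ).integral_comp (hemb θ) f
  have h1 := integral_one_gaussC hν
  simp only [havg, e] at key
  rw [← mul_one (2 * (Real.pi : ℂ) * f 0), integral_const_mul, h1] at key
  have hpi : (2 * Real.pi : ℂ) ≠ 0 := by
    exact_mod_cast Real.two_pi_pos.ne'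
  have : (2 * Real.pi : ℂ) * ∫ ξ, f ξ ∂gaussC ν = (2 * Real.pi : ℂ) * ((Real.pi / ν : ℝ) * f 0) := by
    rw [setIntegral_const, measureReal_def, Real.volume_Ioc, sub_zero,
      ENNReal.toReal_ofReal Real.two_pi_pos.le, Complex.real_smul] at key
    push_cast at key ⊢
    rw [key]
    ring
  exact mul_left_cancel₀ hpi this

/-- The reproducing property of the kernel `exp (ν z ξ̄)` for entire functions of one variable:
the mean value property at the origin, translated to the point `z`. -/
theorem integral_exp_mul_conj_gaussC {ν : ℝ} (hν : 0 < ν) {f : ℂ → ℂ} (hf : Differentiable ℂ f)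
    (z : ℂ) (hi : Integrable (fun ξ => Complex.exp (ν * z * conj ξ) * f ξ) (gaussC ν)) :
    ∫ ξ, Complex.exp (ν * z * conj ξ) * f ξ ∂gaussC ν = (Real.pi / ν : ℝ) * f z := by
  have e : ∀ ξ : ℂ, Complex.exp (-ν * (‖ξ + z‖ : ℂ) ^ 2) *
      (Complex.exp (ν * z * conj (ξ + z)) * f (ξ + z)) =
      Complex.exp (-ν * (‖ξ‖ : ℂ) ^ 2) * (Complex.exp (-ν * conj z * ξ) * f (ξ + z)) := by
    intro ξ
    rw [← mul_assoc, ← mul_assoc, ← Complex.exp_add, ← Complex.exp_add]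
    congr 2
    rw [← Complex.mul_conj', ← Complex.mul_conj']
    simp only [map_add]
    ring
  rw [integrable_gaussC_iff] at hi
  have hi' := hi.comp_add_right z
  simp only [e] at hi'
  rw [integral_gaussC, ← integral_add_right_eq_self _ z]
  simp only [e]
  rw [← integral_gaussC, integral_gaussC_of_differentiable hν (by fun_prop)
    ((integrable_gaussC_iff _ _).2 hi')]
  simp

/-! ### The kernel of the transform and the reproducing kernel -/

/-- The entire part `exp (ν (z ξ̄ + w ξ - z w))` of the kernel of the transform at `p = (z, w)`;
the kernel itself is its product with the Gaussian density `exp (-ν |ξ|²)`. -/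
def entireKernel (ν : ℝ) (p : ℂ × ℂ) (ξ : ℂ) : ℂ :=
  Complex.exp (ν * (p.1 * conj ξ + p.2 * ξ - p.1 * p.2))

/-- The normalizing constant `(ν/π)^{3/2}`. -/
def normConst (ν : ℝ) : ℝ := (ν / Real.pi) ^ (3 / 2 : ℝ)

theorem ofReal_normConst_ne_zero {ν : ℝ} (hν : 0 < ν) : (normConst ν : ℂ) ≠ 0 := by
  exact_mod_cast (Real.rpow_pos_of_pos (div_pos hν Real.pi_pos) _).ne'

theorem normConst_mul_self {ν : ℝ} (hν : 0 < ν) :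
    normConst ν * normConst ν = (ν / Real.pi) ^ 3 := by
  have h : 0 < ν / Real.pi := div_pos hν Real.pi_pos
  rw [normConst, ← Real.rpow_add h, ← Real.rpow_natCast]
  norm_num

theorem kernelT_eq (ν : ℝ) (z w ξ : ℂ) :
    kernelT ν z w ξ = Complex.exp (-ν * (‖ξ‖ : ℂ) ^ 2) * entireKernel ν (z, w) ξ := by
  rw [kernelT, entireKernel, ← Complex.exp_add, ← Complex.mul_conj']
  congr 1
  simp only [RCLike.star_def]
  ring

theorem kernelInv_eq (ν : ℝ) (ξ : ℂ) (p : ℂ × ℂ) :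
    kernelInv ν ξ p = Complex.exp (-ν * ((‖p.1‖ : ℂ) ^ 2 + (‖p.2‖ : ℂ) ^ 2)) *
      conj (entireKernel ν p ξ) := by
  rw [kernelInv, entireKernel, ← Complex.exp_conj, ← Complex.exp_add]
  simp

theorem norm_entireKernel_le {ν : ℝ} (hν : 0 < ν) {p : ℂ × ℂ} {M : ℝ} (hp : ‖p‖ ≤ M) (ξ : ℂ) :
    ‖entireKernel ν p ξ‖ ≤ Real.exp (ν * M ^ 2) * Real.exp (2 * ν * M * ‖ξ‖) := by
  have h1 : ‖p.1‖ ≤ M := (norm_fst_le p).trans hp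
  have h2 : ‖p.2‖ ≤ M := (norm_snd_le p).trans hp
  have hM : 0 ≤ M := (norm_nonneg _).trans hp
  rw [entireKernel, ← Real.exp_add]
  refine (Complex.norm_exp_le_exp_norm _).trans (Real.exp_le_exp.2 ?_)
  rw [norm_mul, Complex.norm_real, Real.norm_of_nonneg hν.le]
  have : ‖p.1 * conj ξ + p.2 * ξ - p.1 * p.2‖ ≤ M * ‖ξ‖ + M * ‖ξ‖ + M * M := by
    refine (norm_sub_le _ _).trans (add_le_add ((norm_add_le _ _).trans (add_le_add ?_ ?_)) ?_)
    · rw [norm_mul, RCLike.norm_conj]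
      gcongr
    · rw [norm_mul]
      gcongr
    · rw [norm_mul]
      gcongr
  calc _ ≤ ν * (M * ‖ξ‖ + M * ‖ξ‖ + M * M) := by gcongr
    _ = _ := by ring

theorem memLp_conj_entireKernel {ν : ℝ} (hν : 0 < ν) (p : ℂ × ℂ) :
    MemLp (fun ξ => (normConst ν : ℂ) * conj (entireKernel ν p ξ)) 2 (gaussC ν) := by
  refine MemLp.const_mul ?_ _
  have hc : Continuous fun ξ => conj (entireKernel ν p ξ) := by
    unfold entireKernel
    fun_prop
  refine ((memLp_exp_mul_norm hν (2 * ν * ‖p‖)).const_mul (Real.exp (ν * ‖p‖ ^ 2))).of_le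
    hc.aestronglyMeasurable (Eventually.of_forall fun ξ => ?_)
  rw [RCLike.norm_conj]
  exact (norm_entireKernel_le hν le_rfl ξ).trans (le_abs_self _)

/-- The vector of `L^{2,ν}(ℂ)` against which the transform at `p` is the inner product. -/
def kernelVec {ν : ℝ} (hν : 0 < ν) (p : ℂ × ℂ) : L2C ν := (memLp_conj_entireKernel hν p).toLp _

theorem inner_kernelVec {ν : ℝ} (hν : 0 < ν) (p : ℂ × ℂ) (ψ : L2C ν) :
    inner ℂ (kernelVec hν p) ψ = normConst ν * ∫ ξ, entireKernel ν p ξ * ψ ξ ∂gaussC ν := by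
  rw [L2.inner_def, ← integral_const_mul]
  refine integral_congr_ae ?_
  filter_upwards [(memLp_conj_entireKernel hν p).coeFn_toLp] with ξ hξ
  rw [kernelVec, hξ]
  simp
  ring

theorem integrable_entireKernel_mul {ν : ℝ} (hν : 0 < ν) (p : ℂ × ℂ) (ψ : L2C ν) :
    Integrable (fun ξ => entireKernel ν p ξ * ψ ξ) (gaussC ν) := by
  have h := (memLp_conj_entireKernel hν p).star.integrable_mul (Lp.memLp ψ)
  have hc := ofReal_normConst_ne_zero hν
  refine (h.const_mul (normConst ν : ℂ)⁻¹).congr (Eventually.of_forall fun ξ => ?_)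
  simp only [Pi.mul_apply, Pi.star_apply, RCLike.star_def, map_mul, Complex.conj_conj,
    Complex.conj_ofReal]
  rw [← mul_assoc, ← mul_assoc, inv_mul_cancel₀ hc, one_mul]

theorem integrable_kernelT_mul {ν : ℝ} (hν : 0 < ν) (ψ : L2C ν) (z w : ℂ) :
    Integrable fun ξ : ℂ => kernelT ν z w ξ * ψ ξ := by
  simp only [kernelT_eq, mul_assoc]
  exact (integrable_gaussC_iff ν _).1 (integrable_entireKernel_mul hν (z, w) ψ)

theorem transformT_eq_inner {ν : ℝ} (hν : 0 < ν) (ψ : L2C ν) (z w : ℂ) :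
    transformT ν ψ z w = inner ℂ (kernelVec hν (z, w)) ψ := by
  rw [inner_kernelVec, integral_gaussC, transformT, normConst]
  simp only [kernelT_eq, mul_assoc]

/-- The reproducing kernel `(ν/π)² exp (ν (ā₁ b₁ + ā₂ b₂))` of the Bargmann–Fock space of `ℂ²`. -/
def fockKernel (ν : ℝ) (a b : ℂ × ℂ) : ℂ :=
  ((ν / Real.pi : ℝ) : ℂ) ^ 2 * Complex.exp (ν * (conj a.1 * b.1 + conj a.2 * b.2))

theorem memLp_fockKernel {ν : ℝ} (hν : 0 < ν) (a : ℂ × ℂ) :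
    MemLp (fockKernel ν a) 2 (gaussC2 ν) := by
  refine MemLp.const_mul ?_ _
  refine (memLp_exp_mul_norm_mul hν (ν * ‖a.1‖) (ν * ‖a.2‖)).of_le
    (Continuous.aestronglyMeasurable (by fun_prop)) (Eventually.of_forall fun b => ?_)
  rw [← Real.exp_add]
  refine (Complex.norm_exp_le_exp_norm _).trans (le_trans (Real.exp_le_exp.2 ?_) (le_abs_self _))
  rw [norm_mul, Complex.norm_real, Real.norm_of_nonneg hν.le]
  have := norm_add_le (conj a.1 * b.1) (conj a.2 * b.2)
  simp only [norm_mul, RCLike.norm_conj] at this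
  calc _ ≤ ν * (‖a.1‖ * ‖b.1‖ + ‖a.2‖ * ‖b.2‖) := by gcongr
    _ = _ := by ring

/-- The reproducing kernel at `a` as an element of the Bargmann–Fock space. -/
def fockKernelVec {ν : ℝ} (hν : 0 < ν) (a : ℂ × ℂ) : FockSpace ν :=
  ⟨fockKernel ν a, by unfold fockKernel; fun_prop, memLp_fockKernel hν a⟩

theorem ofReal_pi_div_mul {ν : ℝ} (hν : 0 < ν) :
    ((Real.pi / ν : ℝ) : ℂ) * ((ν / Real.pi : ℝ) : ℂ) = 1 := by
  rw [← Complex.ofReal_mul, div_mul_div_cancel₀ hν.ne', div_self Real.pi_ne_zero,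
    Complex.ofReal_one]

/-- The reproducing property of the Bargmann–Fock space: the one-variable reproducing property in
each coordinate. -/
theorem integral_conj_fockKernel_mul {ν : ℝ} (hν : 0 < ν) (φ : FockSpace ν) (a : ℂ × ℂ) :
    ∫ b, conj (fockKernel ν a b) * φ b ∂gaussC2 ν = φ a := by
  have hφ : Differentiable ℂ φ.1 := φ.2.1
  have hi : Integrable (fun b => conj (fockKernel ν a b) * φ b) (gaussC2 ν) :=
    (memLp_fockKernel hν a).star.integrable_mul φ.2.2
  have e : ∀ b : ℂ × ℂ, conj (fockKernel ν a b) * φ b =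
      Complex.exp (ν * a.1 * conj b.1) * (((ν / Real.pi : ℝ) : ℂ) ^ 2 *
        Complex.exp (ν * a.2 * conj b.2) * φ b) := by
    intro b
    rw [fockKernel, mul_add, Complex.exp_add]
    simp only [map_mul, map_pow, Complex.conj_ofReal, ← Complex.exp_conj, Complex.conj_conj,
      mul_assoc]
    ring
  simp only [e] at hi ⊢
  rw [gaussC2_eq_prod] at hi ⊢
  rw [integral_prod_symm _ hi]
  have h1 : ∀ᵐ w ∂gaussC ν, ∫ z, Complex.exp (ν * a.1 * conj z) * (((ν / Real.pi : ℝ) : ℂ) ^ 2 *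
        Complex.exp (ν * a.2 * conj w) * φ (z, w)) ∂gaussC ν =
      Complex.exp (ν * a.2 * conj w) * (((ν / Real.pi : ℝ) : ℂ) * φ (a.1, w)) := by
    filter_upwards [hi.swap.prod_right_ae] with w hw
    have hd : Differentiable ℂ fun z : ℂ => φ.1 (z, w) :=
      hφ.comp (differentiable_id.prodMk (differentiable_const w))
    rw [integral_exp_mul_conj_gaussC hν (f := fun z => ((ν / Real.pi : ℝ) : ℂ) ^ 2 *
        Complex.exp (ν * a.2 * conj w) * φ.1 (z, w)) (hd.const_mul _) _ hw]
    linear_combination (((ν / Real.pi : ℝ) : ℂ) * Complex.exp (ν * a.2 * conj w) *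
      φ.1 (a.1, w)) * ofReal_pi_div_mul hν
  have h2 := hi.swap.integral_prod_left.congr h1
  have hd : Differentiable ℂ fun w : ℂ => φ.1 (a.1, w) :=
    hφ.comp ((differentiable_const a.1).prodMk differentiable_id)
  rw [integral_congr_ae h1, integral_exp_mul_conj_gaussC hν (f := fun w =>
    ((ν / Real.pi : ℝ) : ℂ) * φ.1 (a.1, w)) (hd.const_mul _) _ h2, ← mul_assoc,
    ofReal_pi_div_mul hν, one_mul]

/-- The reproducing property, as an inner product in `L^{2,ν}(ℂ²)`. -/
theorem inner_toL2_fockKernelVec {ν : ℝ} (hν : 0 < ν) (a : ℂ × ℂ) (φ : FockSpace ν) :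
    inner ℂ (FockSpace.toL2 ν (fockKernelVec hν a)) (FockSpace.toL2 ν φ) = φ a := by
  rw [L2.inner_def, ← integral_conj_fockKernel_mul hν φ a]
  refine integral_congr_ae ?_
  filter_upwards [(fockKernelVec hν a).2.2.coeFn_toLp, φ.2.2.coeFn_toLp] with b h1 h2
  change inner ℂ (((fockKernelVec hν a).2.2.toLp _ : Lp ℂ 2 (gaussC2 ν)) b)
    ((φ.2.2.toLp _ : Lp ℂ 2 (gaussC2 ν)) b) = _
  rw [h1, h2, RCLike.inner_apply, mul_comm]
  rfl

/-- The Gram matrix of the vectors `kernelVec` is the reproducing kernel. The integral is evaluated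
by the one-variable reproducing property, applied to an exponential function. -/
theorem inner_kernelVec_kernelVec {ν : ℝ} (hν : 0 < ν) (a b : ℂ × ℂ) :
    inner ℂ (kernelVec hν a) (kernelVec hν b) = fockKernel ν b a := by
  have hi := integrable_entireKernel_mul hν a (kernelVec hν b)
  rw [inner_kernelVec]
  have e : (fun ξ => entireKernel ν a ξ * kernelVec hν b ξ) =ᵐ[gaussC ν] fun ξ =>
      Complex.exp (ν * (a.1 + conj b.2) * conj ξ) *
        (normConst ν * Complex.exp (ν * ((a.2 + conj b.1) * ξ - a.1 * a.2 -
          conj b.1 * conj b.2))) := by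
    filter_upwards [(memLp_conj_entireKernel hν b).coeFn_toLp] with ξ hξ
    rw [kernelVec, hξ, mul_left_comm, mul_left_comm (Complex.exp _), entireKernel, entireKernel,
      ← Complex.exp_conj, ← Complex.exp_add, ← Complex.exp_add]
    simp only [map_mul, map_add, map_sub, Complex.conj_conj, Complex.conj_ofReal]
    ring_nf
  rw [integral_congr_ae e, integral_exp_mul_conj_gaussC hν (f := fun ξ => normConst ν *
    Complex.exp (ν * ((a.2 + conj b.1) * ξ - a.1 * a.2 - conj b.1 * conj b.2)))
    (by fun_prop) _ (hi.congr e), fockKernel]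
  have h1 : (ν : ℂ) * ((a.2 + conj b.1) * (a.1 + conj b.2) - a.1 * a.2 - conj b.1 * conj b.2) =
      ν * (conj b.1 * a.1 + conj b.2 * a.2) := by ring
  have h2 : (normConst ν : ℂ) * normConst ν = ((ν / Real.pi : ℝ) : ℂ) ^ 3 := by
    exact_mod_cast normConst_mul_self hν
  rw [h1]
  linear_combination (Real.pi / ν : ℝ) * Complex.exp (ν * (conj b.1 * a.1 + conj b.2 * a.2)) * h2 +
    ((ν / Real.pi : ℝ) : ℂ) ^ 2 * Complex.exp (ν * (conj b.1 * a.1 + conj b.2 * a.2)) *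
      ofReal_pi_div_mul hν

/-! ### Totality of the kernels and the isometry -/

/-- A real integrable function is zero if its Fourier transform vanishes: its positive and
negative parts are the densities of finite measures with the same characteristic function. -/
theorem ae_eq_zero_of_integral_exp_inner_ofReal {g : ℂ → ℝ} (hg : Integrable g)
    (h : ∀ t : ℂ, ∫ ξ, Complex.exp (inner ℝ ξ t * Complex.I) * (g ξ : ℂ) = 0) :
    g =ᵐ[volume] 0 := by
  have hm := hg.aestronglyMeasurable.aemeasurable
  have hfin : ∀ f : ℂ → ℝ, Integrable f →
      IsFiniteMeasure (volume.withDensity fun ξ => ENNReal.ofReal (f ξ)) := fun f hf =>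
    isFiniteMeasure_withDensity_ofReal hf.2
  have := hfin g hg
  have := hfin (fun ξ => -g ξ) hg.neg
  have hi : ∀ (t : ℂ) (f : ℂ → ℝ), Integrable f → Integrable fun ξ : ℂ =>
      Complex.exp (inner ℝ ξ t * Complex.I) * (f ξ : ℂ) := fun t f hf => by
    refine hf.ofReal.bdd_mul (c := 1) (Continuous.aestronglyMeasurable (by fun_prop))
      (Eventually.of_forall fun ξ => ?_)
    rw [Complex.norm_exp_ofReal_mul_I]
  have key : (volume.withDensity fun ξ => ENNReal.ofReal (g ξ)) =
      volume.withDensity fun ξ => ENNReal.ofReal (-g ξ) := by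
    refine Measure.ext_of_charFun (funext fun t => ?_)
    rw [charFun_apply, charFun_apply,
      integral_withDensity_eq_integral_toReal_smul₀ (by fun_prop) (by simp),
      integral_withDensity_eq_integral_toReal_smul₀ (by fun_prop) (by simp), ← sub_eq_zero,
      ← integral_sub]
    · rw [← h t]
      refine integral_congr_ae (Eventually.of_forall fun ξ => ?_)
      simp only [Complex.real_smul, ENNReal.toReal_ofReal']
      rw [← sub_mul, mul_comm, ← Complex.ofReal_sub, max_zero_sub_max_neg_zero_eq_self]
    · refine (hi t _ hg.pos_part).congr (Eventually.of_forall fun ξ => ?_)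
      simp [mul_comm, ENNReal.toReal_ofReal']
    · refine (hi t _ hg.neg_part).congr (Eventually.of_forall fun ξ => ?_)
      simp [mul_comm, ENNReal.toReal_ofReal']
  rw [withDensity_eq_iff_of_sigmaFinite (by fun_prop) (by fun_prop)] at key
  filter_upwards [key] with ξ hξ
  have h1 := congrArg ENNReal.toReal hξ
  rw [ENNReal.toReal_ofReal', ENNReal.toReal_ofReal'] at h1
  have := max_zero_sub_max_neg_zero_eq_self (g ξ)
  rw [max_comm, max_comm (-g ξ)] at this
  simp only [Pi.zero_apply]
  grind

theorem ae_eq_zero_of_integral_exp_inner {f : ℂ → ℂ} (hf : Integrable f)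
    (h : ∀ t : ℂ, ∫ ξ, Complex.exp (inner ℝ ξ t * Complex.I) * f ξ = 0) :
    f =ᵐ[volume] 0 := by
  have hi : ∀ (t : ℂ) (f : ℂ → ℂ), Integrable f → Integrable fun ξ : ℂ =>
      Complex.exp (inner ℝ ξ t * Complex.I) * f ξ := fun t f hf => by
    refine hf.bdd_mul (c := 1) (Continuous.aestronglyMeasurable (by fun_prop))
      (Eventually.of_forall fun ξ => ?_)
    rw [Complex.norm_exp_ofReal_mul_I]
  have hconj : Integrable fun ξ => conj (f ξ) := 
    (RCLike.conjCLE (K := ℂ)).toContinuousLinearMap.integrable_comp hf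
  -- the Fourier transform of the conjugate function vanishes too
  have hc : ∀ t : ℂ, ∫ ξ, Complex.exp (inner ℝ ξ t * Complex.I) * conj (f ξ) = 0 := by
    intro t
    rw [← map_zero conj, ← h (-t), ← integral_conj]
    refine integral_congr_ae (Eventually.of_forall fun ξ => ?_)
    simp only [map_mul, ← Complex.exp_conj, Complex.conj_ofReal, Complex.conj_I, inner_neg_right,
      Complex.ofReal_neg, map_neg, neg_mul_neg]
  have hre := ae_eq_zero_of_integral_exp_inner_ofReal hf.re fun t => by
    have := integral_add (hi t f hf) (hi t _ hconj)
    rw [h t, hc t, add_zero] at this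
    rw [← mul_right_inj' (two_ne_zero (α := ℂ)), mul_zero, ← this, ← integral_const_mul]
    refine integral_congr_ae (Eventually.of_forall fun ξ => ?_)
    simp only [← mul_add, Complex.add_conj, RCLike.re_to_complex]
    push_cast
    ring
  have him := ae_eq_zero_of_integral_exp_inner_ofReal hf.im fun t => by
    have := integral_sub (hi t f hf) (hi t _ hconj)
    rw [h t, hc t, sub_zero] at this
    rw [← mul_right_inj' (mul_ne_zero (two_ne_zero (α := ℂ)) Complex.I_ne_zero), mul_zero,
      ← this, ← integral_const_mul]
    refine integral_congr_ae (Eventually.of_forall fun ξ => ?_)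
    simp only [← mul_sub, Complex.sub_conj, RCLike.im_to_complex]
    push_cast
    ring
  filter_upwards [hre, him] with ξ h1 h2
  exact Complex.ext h1 h2

/-- The vectors `kernelVec` are total. On the points `(z, -z̄)` the transform is, up to non-zero
factors, the Fourier transform of `exp (-ν |ξ|²) ψ`. -/
theorem eq_zero_of_inner_kernelVec {ν : ℝ} (hν : 0 < ν) (ψ : L2C ν)
    (h : ∀ p, inner ℂ (kernelVec hν p) ψ = 0) : ψ = 0 := by
  have hc := ofReal_normConst_ne_zero hν
  have h0 : ∀ p, ∫ ξ, entireKernel ν p ξ * ψ ξ ∂gaussC ν = 0 := fun p => by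
    have := h p
    rw [inner_kernelVec] at this
    exact (mul_eq_zero.1 this).resolve_left hc
  have hψ : Integrable ψ (gaussC ν) := by
    have := isFiniteMeasure_gaussC hν
    exact (Lp.memLp ψ).integrable one_le_two
  have hz := ae_eq_zero_of_integral_exp_inner ((integrable_gaussC_iff ν ψ).1 hψ) fun t => by
    -- with this `z`, the exponent `ν (z ξ̄ - z̄ ξ)` is `i ⟪ξ, t⟫`
    set z : ℂ := Complex.I * t / (2 * ν) with hzdef
    have hν' : (ν : ℂ) ≠ 0 := by exact_mod_cast hν.ne'
    have e : ∀ ξ : ℂ, Complex.exp (inner ℝ ξ t * Complex.I) *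
        (Complex.exp (-ν * (‖ξ‖ : ℂ) ^ 2) * ψ ξ) = Complex.exp (-ν * (z * conj z)) *
        (Complex.exp (-ν * (‖ξ‖ : ℂ) ^ 2) * (entireKernel ν (z, -conj z) ξ * ψ ξ)) := by
      intro ξ
      simp only [← mul_assoc, entireKernel, ← Complex.exp_add]
      congr 2
      have h1 : ((inner ℝ ξ t : ℝ) : ℂ) = (t * conj ξ + conj t * ξ) / 2 := by
        rw [Complex.inner]
        apply Complex.ext
        · simp
        · simp; ring
      rw [h1, hzdef]
      simp only [map_mul, map_div₀, Complex.conj_I, Complex.conj_ofReal, map_ofNat]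
      field_simp
      ring
    simp only [e]
    rw [integral_const_mul, ← integral_gaussC, h0, mul_zero]
  refine (Lp.eq_zero_iff_ae_eq_zero).2 ?_
  have hz' : ∀ᵐ ξ : ℂ, ψ ξ = 0 := by
    filter_upwards [hz] with ξ hξ
    exact (mul_eq_zero.1 hξ).resolve_left (Complex.exp_ne_zero _)
  exact (withDensity_absolutelyContinuous _ _ : gaussC ν ≪ volume).ae_le hz'

/-- The linear combinations of the vectors `kernelVec`. -/
def kernelSpan {ν : ℝ} (hν : 0 < ν) : (ℂ × ℂ →₀ ℂ) →ₗ[ℂ] L2C ν :=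
  Finsupp.linearCombination ℂ (kernelVec hν)

/-- The linear combinations of the reproducing kernels, as functions. -/
def fockSpan {ν : ℝ} (hν : 0 < ν) : (ℂ × ℂ →₀ ℂ) →ₗ[ℂ] FockSpace ν :=
  Finsupp.linearCombination ℂ (fockKernelVec hν)

theorem denseRange_kernelSpan {ν : ℝ} (hν : 0 < ν) : DenseRange (kernelSpan hν) := by
  have h : (LinearMap.range (kernelSpan hν)).topologicalClosure = ⊤ := by
    rw [Submodule.topologicalClosure_eq_top_iff, Submodule.eq_bot_iff]
    intro ψ hψ
    refine eq_zero_of_inner_kernelVec hν ψ fun p => ?_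
    exact (Submodule.mem_orthogonal _ _).1 hψ _ ⟨Finsupp.single p 1, by simp [kernelSpan]⟩
  rw [DenseRange, ← LinearMap.coe_range]
  exact Submodule.dense_iff_topologicalClosure_eq_top.2 h

/-- The value at `b` of a combination of reproducing kernels is the transform at `b` of the same
combination of the vectors `kernelVec`. -/
theorem fockSpan_apply {ν : ℝ} (hν : 0 < ν) (l : ℂ × ℂ →₀ ℂ) (b : ℂ × ℂ) :
    fockSpan hν l b = inner ℂ (kernelVec hν b) (kernelSpan hν l) := by
  induction l using Finsupp.induction_linear with
  | zero => simp [fockSpan, kernelSpan]; rfl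
  | add l l' h h' =>
    rw [map_add, map_add, inner_add_right, ← h, ← h']
    rfl
  | single a c =>
    simp only [fockSpan, kernelSpan, Finsupp.linearCombination_single, inner_smul_right,
      inner_kernelVec_kernelVec]
    rfl

theorem norm_toL2_fockSpan {ν : ℝ} (hν : 0 < ν) (l : ℂ × ℂ →₀ ℂ) :
    ‖FockSpace.toL2 ν (fockSpan hν l)‖ = ‖kernelSpan hν l‖ := by
  have h : inner ℂ (FockSpace.toL2 ν (fockSpan hν l)) (FockSpace.toL2 ν (fockSpan hν l)) =
      inner ℂ (kernelSpan hν l) (kernelSpan hν l) := by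
    suffices ∀ l', inner ℂ (FockSpace.toL2 ν (fockSpan hν l')) (FockSpace.toL2 ν (fockSpan hν l)) =
      inner ℂ (kernelSpan hν l') (kernelSpan hν l) from this l
    intro l'
    induction l' using Finsupp.induction_linear with
    | zero => simp
    | add l l' h h' => simp only [map_add, inner_add_left, h, h']
    | single a c =>
      have h1 : fockSpan hν (Finsupp.single a c) = c • fockKernelVec hν a := by simp [fockSpan]
      have h2 : kernelSpan hν (Finsupp.single a c) = c • kernelVec hν a := by simp [kernelSpan]
      rw [h1, h2, map_smul, inner_smul_left, inner_smul_left, inner_toL2_fockKernelVec,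
        fockSpan_apply]
  rw [inner_self_eq_norm_sq_to_K, inner_self_eq_norm_sq_to_K] at h
  have h' : ‖FockSpace.toL2 ν (fockSpan hν l)‖ ^ 2 = ‖kernelSpan hν l‖ ^ 2 := by
    exact_mod_cast h
  exact (sq_eq_sq₀ (norm_nonneg _) (norm_nonneg _)).1 h'

/-- The transform as a bounded operator from `L^{2,ν}(ℂ)` to `L^{2,ν}(ℂ²)`: the continuous
extension of the map sending each `kernelVec` to the reproducing kernel at the same point. -/
def transformL2 {ν : ℝ} (hν : 0 < ν) : L2C ν →L[ℂ] Lp ℂ 2 (gaussC2 ν) :=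
  (FockSpace.toL2 ν ∘ₗ fockSpan hν).extendOfNorm (kernelSpan hν)

theorem transformL2_kernelSpan {ν : ℝ} (hν : 0 < ν) (l : ℂ × ℂ →₀ ℂ) :
    transformL2 hν (kernelSpan hν l) = FockSpace.toL2 ν (fockSpan hν l) :=
  LinearMap.extendOfNorm_eq (denseRange_kernelSpan hν)
    ⟨1, fun x => by rw [one_mul]; exact (norm_toL2_fockSpan hν x).le⟩ l

theorem transformL2_kernelVec {ν : ℝ} (hν : 0 < ν) (a : ℂ × ℂ) :
    transformL2 hν (kernelVec hν a) = FockSpace.toL2 ν (fockKernelVec hν a) := by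
  simpa [kernelSpan, fockSpan] using transformL2_kernelSpan hν (Finsupp.single a 1)

theorem norm_transformL2 {ν : ℝ} (hν : 0 < ν) (ψ : L2C ν) : ‖transformL2 hν ψ‖ = ‖ψ‖ := by
  refine (denseRange_kernelSpan hν).induction_on
    (p := fun ψ => ‖transformL2 hν ψ‖ = ‖ψ‖) ψ (isClosed_eq (by fun_prop) (by fun_prop)) fun l => ?_
  rw [transformL2_kernelSpan, norm_toL2_fockSpan]

/-- Approximating `ψ` by combinations of kernels gives convergence pointwise and in `L²`, so the
operator `transformL2` is the integral operator. -/
theorem coeFn_transformL2 {ν : ℝ} (hν : 0 < ν) (ψ : L2C ν) :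
    transformL2 hν ψ =ᵐ[gaussC2 ν] fun p => transformT ν ψ p.1 p.2 := by
  obtain ⟨u, hu, hlim⟩ := mem_closure_iff_seq_limit.1 (denseRange_kernelSpan hν ψ)
  choose l hl using hu
  have h1 : Tendsto (fun n => transformL2 hν (u n)) atTop (𝓝 (transformL2 hν ψ)) :=
    ((transformL2 hν).continuous.tendsto ψ).comp hlim
  obtain ⟨k, hk, hae⟩ := (tendstoInMeasure_of_tendsto_Lp h1).exists_seq_tendsto_ae
  have h2 : ∀ᵐ p ∂gaussC2 ν, ∀ n, transformL2 hν (u n) p = fockSpan hν (l n) p := by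
    refine ae_all_iff.2 fun n => ?_
    rw [← hl n, transformL2_kernelSpan]
    exact (fockSpan hν (l n)).2.2.coeFn_toLp
  filter_upwards [hae, h2] with p hp hp2
  refine tendsto_nhds_unique hp ?_
  simp only [hp2, fockSpan_apply, hl, transformT_eq_inner hν]
  exact ((continuous_const.inner continuous_id).tendsto ψ).comp (hlim.comp hk.tendsto_atTop)

/-! ### Holomorphy and surjectivity -/

/-- Differentiation under the integral sign. On the unit ball around `p₀` the linear factor
`‖ξ‖ + M` of the derivative is absorbed into the exponential `exp (‖ξ‖ + M)`. -/
theorem differentiable_integral_entireKernel_mul {ν : ℝ} (hν : 0 < ν) (ψ : L2C ν) :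
    Differentiable ℂ fun p : ℂ × ℂ => ∫ ξ, entireKernel ν p ξ * ψ ξ ∂gaussC ν := by
  intro p₀
  set M : ℝ := ‖p₀‖ + 1
  let F' : ℂ × ℂ → ℂ → (ℂ × ℂ →L[ℂ] ℂ) := fun p ξ =>
    (entireKernel ν p ξ * ψ ξ) • (ν : ℂ) • ((conj ξ - p.2) • ContinuousLinearMap.fst ℂ ℂ ℂ +
      (ξ - p.1) • ContinuousLinearMap.snd ℂ ℂ ℂ)
  have hmem : ∀ p ∈ Metric.ball p₀ 1, ‖p‖ ≤ M := fun p hp => by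
    rw [mem_ball_iff_norm] at hp
    have := norm_le_norm_add_norm_sub' p p₀
    linarith
  have hd : ∀ ξ p, HasFDerivAt (fun p => entireKernel ν p ξ * ψ ξ) (F' p ξ) p := by
    intro ξ p
    have h1 : HasFDerivAt (fun p : ℂ × ℂ => p.1) (ContinuousLinearMap.fst ℂ ℂ ℂ) p :=
      hasFDerivAt_fst
    have h2 : HasFDerivAt (fun p : ℂ × ℂ => p.2) (ContinuousLinearMap.snd ℂ ℂ ℂ) p :=
      hasFDerivAt_snd
    have h := (((((h1.mul_const (conj ξ)).add (h2.mul_const ξ)).sub (h1.mul h2)).const_mul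
      (ν : ℂ)).cexp).mul_const (ψ ξ)
    refine h.congr_fderiv ?_
    ext <;> simp [F', entireKernel] <;> ring
  refine HasFDerivAt.differentiableAt (hasFDerivAt_integral_of_dominated_of_fderiv_le
    (F' := F') (s := Metric.ball p₀ 1)
    (bound := fun ξ => Real.exp (ν * M ^ 2) * (2 * ν * Real.exp M) *
      (Real.exp ((2 * ν * M + 1) * ‖ξ‖) * ‖ψ ξ‖))
    (Metric.ball_mem_nhds p₀ one_pos) ?_ (integrable_entireKernel_mul hν p₀ ψ) ?_ ?_ ?_
    (Eventually.of_forall fun ξ p _ => hd ξ p))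
  · exact Eventually.of_forall fun p => (integrable_entireKernel_mul hν p ψ).1
  · refine (integrable_entireKernel_mul hν p₀ ψ).1.smul (Continuous.aestronglyMeasurable ?_)
    fun_prop
  · refine Eventually.of_forall fun ξ p hp => ?_
    have hp' := hmem p hp
    have h1 := (norm_fst_le p).trans hp'
    have h2 := (norm_snd_le p).trans hp'
    have hlin : ‖(conj ξ - p.2) • ContinuousLinearMap.fst ℂ ℂ ℂ +
        (ξ - p.1) • ContinuousLinearMap.snd ℂ ℂ ℂ‖ ≤ 2 * Real.exp (‖ξ‖ + M) := by
      have e1 : ‖conj ξ - p.2‖ ≤ ‖ξ‖ + M := by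
        have := norm_sub_le (conj ξ) p.2
        rw [RCLike.norm_conj] at this
        linarith
      have e2 : ‖ξ - p.1‖ ≤ ‖ξ‖ + M := by
        have := norm_sub_le ξ p.1
        linarith
      have e3 := Real.add_one_le_exp (‖ξ‖ + M)
      refine (norm_add_le _ _).trans ?_
      rw [norm_smul, norm_smul]
      have f1 := mul_le_mul e1 (ContinuousLinearMap.norm_fst_le ℂ ℂ ℂ) (norm_nonneg _)
        ((norm_nonneg _).trans e1)
      have f2 := mul_le_mul e2 (ContinuousLinearMap.norm_snd_le ℂ ℂ ℂ) (norm_nonneg _)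
        ((norm_nonneg _).trans e2)
      linarith
    calc ‖F' p ξ‖ ≤ (Real.exp (ν * M ^ 2) * Real.exp (2 * ν * M * ‖ξ‖) * ‖ψ ξ‖) *
          (ν * (2 * Real.exp (‖ξ‖ + M))) := by
          simp only [F', norm_smul, norm_mul, Complex.norm_real, Real.norm_of_nonneg hν.le]
          gcongr
          exact norm_entireKernel_le hν hp' ξ
      _ = _ := by
          rw [Real.exp_add ‖ξ‖ M, add_mul, one_mul, Real.exp_add (2 * ν * M * ‖ξ‖)]
          ring
  · exact ((memLp_exp_mul_norm hν _).integrable_mul (Lp.memLp ψ).norm).const_mul _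

/-- The transform of `ψ` as an element of the Bargmann–Fock space. -/
def transformFock {ν : ℝ} (hν : 0 < ν) (ψ : L2C ν) : FockSpace ν :=
  ⟨fun p => transformT ν ψ p.1 p.2, by
    simp only [transformT_eq_inner hν, inner_kernelVec]
    exact (differentiable_integral_entireKernel_mul hν ψ).const_mul _,
    (memLp_congr_ae (coeFn_transformL2 hν ψ)).1 (Lp.memLp _)⟩

theorem toL2_transformFock {ν : ℝ} (hν : 0 < ν) (ψ : L2C ν) :
    FockSpace.toL2 ν (transformFock hν ψ) = transformL2 hν ψ :=
  Lp.ext ((transformFock hν ψ).2.2.coeFn_toLp.trans (coeFn_transformL2 hν ψ).symm)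

/-- The adjoint of the transform is a right inverse on the Bargmann–Fock space: both sides have
the same inner products with the reproducing kernels. -/
theorem transformFock_adjoint {ν : ℝ} (hν : 0 < ν) (φ : FockSpace ν) :
    transformFock hν (ContinuousLinearMap.adjoint (transformL2 hν) (FockSpace.toL2 ν φ)) = φ := by
  refine Subtype.ext (funext fun a => ?_)
  change transformT ν _ a.1 a.2 = φ a
  rw [transformT_eq_inner hν, ContinuousLinearMap.adjoint_inner_right, transformL2_kernelVec,
    inner_toL2_fockKernelVec]

/-- The transform as a unitary operator onto the Bargmann–Fock space. -/
def transformEquiv {ν : ℝ} (hν : 0 < ν) : L2C ν ≃ₗᵢ[ℂ] FockSpace ν :=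
  LinearIsometryEquiv.ofSurjective
    { toFun := transformFock hν
      map_add' := fun ψ ψ' => FockSpace.toL2_injective ν (by
        simp only [map_add, toL2_transformFock])
      map_smul' := fun c ψ => FockSpace.toL2_injective ν (by
        simp only [map_smul, toL2_transformFock, RingHom.id_apply])
      norm_map' := fun ψ => by
        change ‖FockSpace.toL2 ν (transformFock hν ψ)‖ = ‖ψ‖
        rw [toL2_transformFock, norm_transformL2] }
    fun φ => ⟨_, transformFock_adjoint hν φ⟩

theorem transformEquiv_symm_apply {ν : ℝ} (hν : 0 < ν) (φ : FockSpace ν) :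
    (transformEquiv hν).symm φ =
      ContinuousLinearMap.adjoint (transformL2 hν) (FockSpace.toL2 ν φ) :=
  (transformEquiv hν).symm_apply_eq.2 (transformFock_adjoint hν φ).symm

/-! ### The inversion integral -/

theorem measurableSet_ballC2 (R : ℝ) : MeasurableSet (ballC2 R) :=
  measurableSet_lt (by fun_prop) (by fun_prop)

theorem norm_le_of_mem_ballC2 {R : ℝ} {p : ℂ × ℂ} (hp : p ∈ ballC2 R) : ‖p‖ ≤ |R| := by
  have hp' : ‖p.1‖ ^ 2 + ‖p.2‖ ^ 2 < R ^ 2 := hp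
  exact max_le
    ((pow_le_pow_iff_left₀ (norm_nonneg _) (abs_nonneg _) two_ne_zero).1
      (by rw [sq_abs]; linarith [sq_nonneg ‖p.2‖]))
    ((pow_le_pow_iff_left₀ (norm_nonneg _) (abs_nonneg _) two_ne_zero).1
      (by rw [sq_abs]; linarith [sq_nonneg ‖p.1‖]))

theorem memLp_indicator_ballC2 {ν : ℝ} (φ : FockSpace ν) (R : ℝ) :
    MemLp ((ballC2 R).indicator φ.1) 2 (gaussC2 ν) :=
  φ.2.2.indicator (measurableSet_ballC2 R)

theorem norm_conj_entireKernel_mul_indicator_le {ν : ℝ} (hν : 0 < ν) (f : ℂ × ℂ → ℂ) (R : ℝ)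
    (ξ : ℂ) (p : ℂ × ℂ) :
    ‖conj (entireKernel ν p ξ) * (ballC2 R).indicator f p‖ ≤
      Real.exp (ν * R ^ 2) * Real.exp (2 * ν * |R| * ‖ξ‖) * ‖(ballC2 R).indicator f p‖ := by
  by_cases hp : p ∈ ballC2 R
  · rw [norm_mul, RCLike.norm_conj]
    gcongr
    simpa using norm_entireKernel_le hν (norm_le_of_mem_ballC2 hp) ξ
  · simp [hp]

theorem integrable_conj_entireKernel_mul_indicator {ν : ℝ} (hν : 0 < ν) (φ : FockSpace ν) (R : ℝ)
    (ξ : ℂ) :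
    Integrable (fun p => conj (entireKernel ν p ξ) * (ballC2 R).indicator φ.1 p) (gaussC2 ν) := by
  have := isFiniteMeasure_gaussC2 hν
  have hf := (memLp_indicator_ballC2 φ R).integrable one_le_two
  refine (hf.norm.const_mul _).mono' (AEStronglyMeasurable.mul (Continuous.aestronglyMeasurable ?_)
    hf.1) (Eventually.of_forall fun p => norm_conj_entireKernel_mul_indicator_le hν _ R ξ p)
  unfold entireKernel
  fun_prop

theorem integrableOn_kernelInv_mul {ν : ℝ} (hν : 0 < ν) (φ : FockSpace ν) (R : ℝ) (ξ : ℂ) :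
    IntegrableOn (fun p => kernelInv ν ξ p * φ p) (ballC2 R) := by
  rw [← integrable_indicator_iff (measurableSet_ballC2 R)]
  refine ((integrable_gaussC2_iff ν _).1
    (integrable_conj_entireKernel_mul_indicator hν φ R ξ)).congr (Eventually.of_forall fun p => ?_)
  by_cases hp : p ∈ ballC2 R <;> simp [hp, kernelInv_eq, mul_assoc]

theorem inverseIntegral_ballC2 (ν : ℝ) (φ : ℂ × ℂ → ℂ) (R : ℝ) (ξ : ℂ) :
    inverseIntegral ν (ballC2 R) φ ξ = normConst ν *
      ∫ p, conj (entireKernel ν p ξ) * (ballC2 R).indicator φ p ∂gaussC2 ν := by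
  rw [inverseIntegral, integral_gaussC2, normConst, ← integral_indicator (measurableSet_ballC2 R)]
  congr 1
  refine integral_congr_ae (Eventually.of_forall fun p => ?_)
  by_cases hp : p ∈ ballC2 R <;> simp [hp, kernelInv_eq, mul_assoc]

theorem memLp_inverseIntegral_ballC2 {ν : ℝ} (hν : 0 < ν) (φ : FockSpace ν) (R : ℝ) :
    MemLp (inverseIntegral ν (ballC2 R) φ) 2 (gaussC ν) := by
  have := isFiniteMeasure_gaussC2 hν
  have hf := (memLp_indicator_ballC2 φ R).integrable one_le_two
  have e : inverseIntegral ν (ballC2 R) φ = fun ξ => normConst ν *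
      ∫ p, conj (entireKernel ν p ξ) * (ballC2 R).indicator φ.1 p ∂gaussC2 ν :=
    funext fun ξ => inverseIntegral_ballC2 ν φ R ξ
  rw [e]
  refine MemLp.const_mul ?_ _
  refine ((memLp_exp_mul_norm hν (2 * ν * |R|)).const_mul (Real.exp (ν * R ^ 2) *
    ∫ p, ‖(ballC2 R).indicator φ.1 p‖ ∂gaussC2 ν)).of_le ?_ (Eventually.of_forall fun ξ => ?_)
  · refine StronglyMeasurable.aestronglyMeasurable (StronglyMeasurable.integral_prod_left
      (f := fun p ξ => conj (entireKernel ν p ξ) * (ballC2 R).indicator φ.1 p) ?_)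
    have hφ : Differentiable ℂ φ.1 := φ.2.1
    refine StronglyMeasurable.mul (Continuous.stronglyMeasurable ?_)
      ((hφ.continuous.stronglyMeasurable.indicator
        (measurableSet_ballC2 R)).comp_measurable measurable_fst)
    unfold entireKernel
    fun_prop
  · refine le_trans ?_ (le_abs_self _)
    refine (norm_integral_le_integral_norm _).trans ((integral_mono_of_nonneg
      (Eventually.of_forall fun _ => norm_nonneg _) (hf.norm.const_mul _)
      (Eventually.of_forall fun p =>
        norm_conj_entireKernel_mul_indicator_le hν φ.1 R ξ p)).trans_eq ?_)
    rw [integral_const_mul]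
    ring

/-- By Fubini, the adjoint of the transform on functions of bounded support is the inversion
integral. -/
theorem toLp_inverseIntegral_ballC2 {ν : ℝ} (hν : 0 < ν) (φ : FockSpace ν) (R : ℝ) :
    (memLp_inverseIntegral_ballC2 hν φ R).toLp _ =
      ContinuousLinearMap.adjoint (transformL2 hν) ((memLp_indicator_ballC2 φ R).toLp _) := by
  have := isFiniteMeasure_gaussC2 hν
  have hf := (memLp_indicator_ballC2 φ R).integrable one_le_two
  refine ext_inner_right ℂ fun ψ => ?_
  rw [ContinuousLinearMap.adjoint_inner_left, L2.inner_def, L2.inner_def]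
  have e1 : (fun ξ => inner ℂ ((memLp_inverseIntegral_ballC2 hν φ R).toLp _ ξ) (ψ ξ))
      =ᵐ[gaussC ν] fun ξ => ∫ p, normConst ν * (conj ((ballC2 R).indicator φ.1 p) *
        (entireKernel ν p ξ * ψ ξ)) ∂gaussC2 ν := by
    filter_upwards [(memLp_inverseIntegral_ballC2 hν φ R).coeFn_toLp] with ξ hξ
    rw [hξ, inverseIntegral_ballC2, RCLike.inner_apply, map_mul, ← integral_conj,
      Complex.conj_ofReal, mul_comm, mul_assoc, ← integral_mul_const, ← integral_const_mul]
    refine integral_congr_ae (Eventually.of_forall fun p => ?_)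
    simp only [map_mul, Complex.conj_conj]
    ring
  have e2 : (fun p => inner ℂ ((memLp_indicator_ballC2 φ R).toLp _ p) (transformL2 hν ψ p))
      =ᵐ[gaussC2 ν] fun p => ∫ ξ, normConst ν * (conj ((ballC2 R).indicator φ.1 p) *
        (entireKernel ν p ξ * ψ ξ)) ∂gaussC ν := by
    filter_upwards [(memLp_indicator_ballC2 φ R).coeFn_toLp, coeFn_transformL2 hν ψ] with p h1 h2
    rw [h1, h2, transformT_eq_inner hν, inner_kernelVec, integral_const_mul, integral_const_mul,
      RCLike.inner_apply]
    ring
  rw [integral_congr_ae e1, integral_congr_ae e2]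
  refine integral_integral_swap (f := fun ξ p => (normConst ν : ℂ) *
    (conj ((ballC2 R).indicator φ.1 p) * (entireKernel ν p ξ * ψ ξ))) (Integrable.const_mul ?_ _)
  have hψ := ((memLp_exp_mul_norm hν (2 * ν * |R|)).const_mul (Real.exp (ν * R ^ 2))).integrable_mul
    (Lp.memLp ψ).norm
  refine (hψ.mul_prod hf.norm).mono' ?_ (Eventually.of_forall fun q => ?_)
  · refine AEStronglyMeasurable.mul (Complex.continuous_conj.comp_aestronglyMeasurable
      hf.1.comp_snd) (AEStronglyMeasurable.mul (Continuous.aestronglyMeasurable ?_)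
      (Lp.aestronglyMeasurable ψ).comp_fst)
    unfold entireKernel
    fun_prop
  · have h := norm_conj_entireKernel_mul_indicator_le hν φ.1 R q.1 q.2
    rw [norm_mul, RCLike.norm_conj] at h
    calc _ = ‖entireKernel ν q.2 q.1‖ * ‖(ballC2 R).indicator φ.1 q.2‖ * ‖ψ q.1‖ := by
          rw [norm_mul, norm_mul, RCLike.norm_conj]
          ring
      _ ≤ _ := mul_le_mul_of_nonneg_right h (norm_nonneg _)
      _ = _ := by
          simp only [Pi.mul_apply]
          ring

theorem tendsto_indicator_ballC2 (p : ℂ × ℂ) (f : ℂ × ℂ → ℂ) :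
    ∀ᶠ R in atTop, (ballC2 R).indicator f p = f p := by
  filter_upwards [eventually_gt_atTop (‖p.1‖ ^ 2 + ‖p.2‖ ^ 2 + 1)] with R hR
  refine Set.indicator_of_mem ?_ f
  change ‖p.1‖ ^ 2 + ‖p.2‖ ^ 2 < R ^ 2
  nlinarith [sq_nonneg ‖p.1‖, sq_nonneg ‖p.2‖]

theorem tendsto_toLp_indicator_ballC2 {ν : ℝ} (φ : FockSpace ν) :
    Tendsto (fun R : ℝ => (memLp_indicator_ballC2 φ R).toLp _) atTop
      (𝓝 (FockSpace.toL2 ν φ)) := by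
  change Tendsto _ atTop (𝓝 (φ.2.2.toLp φ.1))
  rw [Lp.tendsto_Lp_iff_tendsto_eLpNorm'']
  simp only [eLpNorm_eq_lintegral_rpow_enorm_toReal two_ne_zero ENNReal.ofNat_ne_top]
  have h : Tendsto (fun R : ℝ => ∫⁻ p, ‖((ballC2 R).indicator φ.1 - φ.1) p‖ₑ ^
      (2 : ENNReal).toReal ∂gaussC2 ν) atTop (𝓝 (∫⁻ _, 0 ∂gaussC2 ν)) := by
    refine tendsto_lintegral_filter_of_dominated_convergence
      (fun p => ‖φ.1 p‖ₑ ^ (2 : ENNReal).toReal) (Eventually.of_forall fun R => ?_)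
      (Eventually.of_forall fun R => Eventually.of_forall fun p => ?_)
      (lintegral_rpow_enorm_lt_top_of_eLpNorm_lt_top two_ne_zero ENNReal.ofNat_ne_top
        φ.2.2.2).ne (Eventually.of_forall fun p => ?_)
    · have hφ : Differentiable ℂ φ.1 := φ.2.1
      have := hφ.continuous.measurable
      have := this.indicator (measurableSet_ballC2 R)
      fun_prop
    · refine ENNReal.rpow_le_rpow ?_ (by simp)
      by_cases hp : p ∈ ballC2 R <;> simp [hp]
    · refine tendsto_const_nhds.congr' ?_
      filter_upwards [tendsto_indicator_ballC2 p φ.1] with R hR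
      simp [hR]
  have h' := h.ennrpow_const (1 / (2 : ENNReal).toReal)
  simpa using h'

theorem tendsto_toLp_inverseIntegral {ν : ℝ} (hν : 0 < ν) (φ : FockSpace ν) :
    Tendsto (fun R : ℝ => (memLp_inverseIntegral_ballC2 hν φ R).toLp _) atTop
      (𝓝 ((transformEquiv hν).symm φ)) := by
  rw [transformEquiv_symm_apply]
  exact (((ContinuousLinearMap.adjoint (transformL2 hν)).continuous.tendsto _).comp
    (tendsto_toLp_indicator_ballC2 φ)).congr fun R => (toLp_inverseIntegral_ballC2 hν φ R).symm

theorem tendsto_eLpNorm_inverseIntegral_sub {ν : ℝ} (hν : 0 < ν) (φ : FockSpace ν) :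
    Tendsto (fun R : ℝ => eLpNorm
      (fun ξ => inverseIntegral ν (ballC2 R) φ ξ - (transformEquiv hν).symm φ ξ) 2 (gaussC ν))
      atTop (𝓝 0) := by
  refine ((Lp.tendsto_Lp_iff_tendsto_eLpNorm' _ _).1 (tendsto_toLp_inverseIntegral hν φ)).congr
    fun R => eLpNorm_congr_ae ?_
  filter_upwards [(memLp_inverseIntegral_ballC2 hν φ R).coeFn_toLp] with ξ hξ
  simp [hξ]

theorem tendsto_inverseIntegral_ballC2 {ν : ℝ} {φ : ℂ × ℂ → ℂ} {ξ : ℂ}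
    (h : Integrable fun p => kernelInv ν ξ p * φ p) :
    Tendsto (fun R : ℝ => inverseIntegral ν (ballC2 R) φ ξ) atTop
      (𝓝 (inverseIntegral ν Set.univ φ ξ)) := by
  refine Tendsto.const_mul _ ?_
  simp only [← integral_indicator (measurableSet_ballC2 _), setIntegral_univ]
  refine tendsto_integral_filter_of_dominated_convergence (fun p => ‖kernelInv ν ξ p * φ p‖)
    (Eventually.of_forall fun R => h.1.indicator (measurableSet_ballC2 R))
    (Eventually.of_forall fun R => Eventually.of_forall fun p => norm_indicator_le_norm_self _ _)
    h.norm (Eventually.of_forall fun p => ?_)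
  refine tendsto_const_nhds.congr' ?_
  filter_upwards [tendsto_indicator_ballC2 p fun p => kernelInv ν ξ p * φ p] with R hR
  exact hR.symm

/-- An almost everywhere convergent subsequence of the inversion integrals over balls identifies
the inverse transform at the points of absolute convergence. -/
theorem ae_symm_eq_inverseIntegral {ν : ℝ} (hν : 0 < ν) (φ : FockSpace ν) :
    ∀ᵐ ξ : ℂ, Integrable (fun p => kernelInv ν ξ p * φ p) →
      (transformEquiv hν).symm φ ξ = inverseIntegral ν Set.univ φ ξ := by
  obtain ⟨k, hk, hae⟩ := (tendstoInMeasure_of_tendsto_Lp ((tendsto_toLp_inverseIntegral hν φ).comp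
    tendsto_natCast_atTop_atTop)).exists_seq_tendsto_ae
  have h2 : ∀ᵐ ξ ∂gaussC ν, ∀ n : ℕ, (memLp_inverseIntegral_ballC2 hν φ n).toLp _ ξ =
      inverseIntegral ν (ballC2 n) φ ξ :=
    ae_all_iff.2 fun n => (memLp_inverseIntegral_ballC2 hν φ n).coeFn_toLp
  refine (volume_absolutelyContinuous_gaussC ν).ae_le ?_
  filter_upwards [hae, h2] with ξ h1 h2 hi
  simp only [Function.comp_apply, h2] at h1
  exact tendsto_nhds_unique h1 ((tendsto_inverseIntegral_ballC2 hi).comp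
    (tendsto_natCast_atTop_atTop.comp hk.tendsto_atTop))

/-! ### Complex Hermite polynomials -/

theorem fderiv_apply_eq_wirtinger (f : ℂ → ℂ) (ξ v : ℂ) :
    fderiv ℝ f ξ v = wirtinger f ξ * v + wirtingerBar f ξ * conj v := by
  have hv : v = v.re • (1 : ℂ) + v.im • Complex.I := by simp
  have h1 : fderiv ℝ f ξ v = v.re * fderiv ℝ f ξ 1 + v.im * fderiv ℝ f ξ Complex.I := by
    conv_lhs => rw [hv]
    rw [map_add, map_smul, map_smul, Complex.real_smul, Complex.real_smul]
  have h2 : v = v.re + v.im * Complex.I := (Complex.re_add_im v).symm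
  have h3 : conj v = v.re - v.im * Complex.I := by
    apply Complex.ext <;> simp
  rw [h1, wirtinger, wirtingerBar, h3]
  conv_rhs => rw [h2]
  simp only [Complex.add_re, Complex.ofReal_re, Complex.mul_re, Complex.I_re, Complex.ofReal_im,
    Complex.I_im, Complex.add_im, Complex.mul_im, mul_zero, mul_one, sub_zero, add_zero,
    zero_add]
  linear_combination (v.im * fderiv ℝ f ξ Complex.I) * Complex.I_mul_I

/-- The Wirtinger derivatives are the coefficients of `v` and `v̄` in the real derivative. -/
theorem wirtinger_eq_of_hasFDerivAt {f : ℂ → ℂ} {ξ A B : ℂ}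
    (h : HasFDerivAt f (A • (1 : ℂ →L[ℝ] ℂ) + B • (Complex.conjCLE : ℂ →L[ℝ] ℂ)) ξ) :
    wirtinger f ξ = A ∧ wirtingerBar f ξ = B := by
  constructor
  · rw [wirtinger, h.fderiv]
    simp
    linear_combination (-A / 2 + B / 2) * Complex.I_mul_I
  · rw [wirtingerBar, h.fderiv]
    simp
    linear_combination (A / 2 - B / 2) * Complex.I_mul_I

/-- The product of the monomial `ξ^a ξ̄^b` and the Gaussian `exp (-ν ξ ξ̄)`. -/
def gaussMonomial (ν : ℝ) (a b : ℕ) (ξ : ℂ) : ℂ :=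
  ξ ^ a * conj ξ ^ b * Complex.exp (-(ν : ℂ) * ξ * star ξ)

/-- The space of polynomials in `ξ` and `ξ̄` times the Gaussian; it contains all the Wirtinger
derivatives of the Gaussian. -/
def gaussPoly (ν : ℝ) : Submodule ℂ (ℂ → ℂ) :=
  Submodule.span ℂ (Set.range fun i : ℕ × ℕ => gaussMonomial ν i.1 i.2)

theorem gaussMonomial_mem (ν : ℝ) (a b : ℕ) : gaussMonomial ν a b ∈ gaussPoly ν :=
  Submodule.subset_span ⟨(a, b), rfl⟩

theorem hasFDerivAt_gaussMonomial (ν : ℝ) (a b : ℕ) (ξ : ℂ) :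
    HasFDerivAt (gaussMonomial ν a b)
      ((a * gaussMonomial ν (a - 1) b ξ - ν * gaussMonomial ν a (b + 1) ξ) • (1 : ℂ →L[ℝ] ℂ) +
        (b * gaussMonomial ν a (b - 1) ξ - ν * gaussMonomial ν (a + 1) b ξ) •
          (Complex.conjCLE : ℂ →L[ℝ] ℂ)) ξ := by
  have h1 : HasFDerivAt (fun z : ℂ => z) (1 : ℂ →L[ℝ] ℂ) ξ := hasFDerivAt_id ξ
  have h2 : HasFDerivAt (fun z : ℂ => conj z) (Complex.conjCLE : ℂ →L[ℝ] ℂ) ξ :=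
    Complex.conjCLE.hasFDerivAt
  have h := ((h1.pow a).mul (h2.pow b)).mul (((h1.const_mul (-(ν : ℂ))).mul h2).cexp)
  refine h.congr_fderiv ?_
  ext v
  simp [gaussMonomial]
  ring

theorem differentiable_of_mem_gaussPoly {ν : ℝ} {f : ℂ → ℂ} (hf : f ∈ gaussPoly ν) :
    Differentiable ℝ f := by
  induction hf using Submodule.span_induction with
  | mem f hf =>
    obtain ⟨i, rfl⟩ := hf
    exact fun ξ => (hasFDerivAt_gaussMonomial ν i.1 i.2 ξ).differentiableAt
  | zero => exact differentiable_const 0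
  | add f g _ _ hf hg => exact hf.add hg
  | smul c f _ hf => exact hf.const_smul c

theorem wirtinger_mem_gaussPoly {ν : ℝ} {f : ℂ → ℂ} (hf : f ∈ gaussPoly ν) :
    wirtinger f ∈ gaussPoly ν ∧ wirtingerBar f ∈ gaussPoly ν := by
  induction hf using Submodule.span_induction with
  | mem f hf =>
    obtain ⟨i, rfl⟩ := hf
    have h := fun ξ => wirtinger_eq_of_hasFDerivAt (hasFDerivAt_gaussMonomial ν i.1 i.2 ξ)
    constructor
    · rw [show wirtinger (gaussMonomial ν i.1 i.2) = (i.1 : ℂ) • gaussMonomial ν (i.1 - 1) i.2 -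
        (ν : ℂ) • gaussMonomial ν i.1 (i.2 + 1) from funext fun ξ => (h ξ).1]
      exact sub_mem (Submodule.smul_mem _ _ (gaussMonomial_mem _ _ _))
        (Submodule.smul_mem _ _ (gaussMonomial_mem _ _ _))
    · rw [show wirtingerBar (gaussMonomial ν i.1 i.2) =
        (i.2 : ℂ) • gaussMonomial ν i.1 (i.2 - 1) - (ν : ℂ) • gaussMonomial ν (i.1 + 1) i.2 from
        funext fun ξ => (h ξ).2]
      exact sub_mem (Submodule.smul_mem _ _ (gaussMonomial_mem _ _ _))
        (Submodule.smul_mem _ _ (gaussMonomial_mem _ _ _))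
  | zero =>
    have h1 : wirtinger 0 = 0 := by ext ξ; simp [wirtinger]
    have h2 : wirtingerBar 0 = 0 := by ext ξ; simp [wirtingerBar]
    rw [h1, h2]
    exact ⟨zero_mem _, zero_mem _⟩
  | add f g hf' hg' hf hg =>
    have df := differentiable_of_mem_gaussPoly hf'
    have dg := differentiable_of_mem_gaussPoly hg'
    have h1 : wirtinger (f + g) = wirtinger f + wirtinger g := by
      ext ξ
      simp only [wirtinger, Pi.add_apply, fderiv_add (df ξ) (dg ξ), add_apply]
      ring
    have h2 : wirtingerBar (f + g) = wirtingerBar f + wirtingerBar g := by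
      ext ξ
      simp only [wirtingerBar, Pi.add_apply, fderiv_add (df ξ) (dg ξ),
        add_apply]
      ring
    rw [h1, h2]
    exact ⟨add_mem hf.1 hg.1, add_mem hf.2 hg.2⟩
  | smul c f hf' hf =>
    have df := differentiable_of_mem_gaussPoly hf'
    have h1 : wirtinger (c • f) = c • wirtinger f := by
      ext ξ
      simp only [wirtinger, Pi.smul_apply, fderiv_const_smul (df ξ), smul_apply,
        smul_eq_mul]
      ring
    have h2 : wirtingerBar (c • f) = c • wirtingerBar f := by
      ext ξ
      simp only [wirtingerBar, Pi.smul_apply, fderiv_const_smul (df ξ),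
        smul_apply, smul_eq_mul]
      ring
    rw [h1, h2]
    exact ⟨Submodule.smul_mem _ _ hf.1, Submodule.smul_mem _ _ hf.2⟩

theorem integrable_entireKernel_mul_of_mem_gaussPoly {ν : ℝ} (hν : 0 < ν) (p : ℂ × ℂ) {f : ℂ → ℂ}
    (hf : f ∈ gaussPoly ν) : Integrable fun ξ => entireKernel ν p ξ * f ξ := by
  induction hf using Submodule.span_induction with
  | mem f hf =>
    obtain ⟨⟨a, b⟩, rfl⟩ := hf
    have h : Integrable (fun ξ => entireKernel ν p ξ * (ξ ^ a * conj ξ ^ b)) (gaussC ν) := by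
      refine ((integrable_exp_mul_norm hν (2 * ν * ‖p‖ + (a + b))).const_mul
        (Real.exp (ν * ‖p‖ ^ 2))).mono' (Continuous.aestronglyMeasurable ?_)
        (Eventually.of_forall fun ξ => ?_)
      · unfold entireKernel
        fun_prop
      · have hb : ‖ξ ^ a * conj ξ ^ b‖ ≤ Real.exp ((a + b) * ‖ξ‖) := by
          rw [norm_mul, norm_pow, norm_pow, RCLike.norm_conj, ← pow_add]
          calc ‖ξ‖ ^ (a + b) ≤ Real.exp ‖ξ‖ ^ (a + b) := by
                gcongr
                linarith [Real.add_one_le_exp ‖ξ‖]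
            _ = _ := by rw [← Real.exp_nat_mul]; push_cast; rfl
        rw [norm_mul, add_mul, Real.exp_add, ← mul_assoc]
        exact mul_le_mul (norm_entireKernel_le hν le_rfl ξ) hb (norm_nonneg _) (by positivity)
    refine ((integrable_gaussC_iff ν _).1 h).congr (Eventually.of_forall fun ξ => ?_)
    simp only [gaussMonomial, ← Complex.mul_conj', RCLike.star_def, mul_assoc]
    ring
  | zero => simp
  | add f g _ _ hf hg =>
    exact (hf.add hg).congr (Eventually.of_forall fun ξ => (mul_add _ _ _).symm)
  | smul c f _ hf =>
    simpa only [Pi.smul_apply, smul_eq_mul, mul_left_comm] using hf.const_mul c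

/-- Integration by parts against the exponential factor, whose derivatives with respect to `ξ` and
`ξ̄` are its multiples by `ν w` and `ν z`. -/
theorem integral_entireKernel_mul_wirtinger {ν : ℝ} (hν : 0 < ν) (p : ℂ × ℂ) {f : ℂ → ℂ}
    (hf : f ∈ gaussPoly ν) :
    ∫ ξ, entireKernel ν p ξ * wirtinger f ξ = -(ν * p.2) * ∫ ξ, entireKernel ν p ξ * f ξ ∧
    ∫ ξ, entireKernel ν p ξ * wirtingerBar f ξ =
      -(ν * p.1) * ∫ ξ, entireKernel ν p ξ * f ξ := by
  have hi := fun {g : ℂ → ℂ} (hg : g ∈ gaussPoly ν) =>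
    integrable_entireKernel_mul_of_mem_gaussPoly hν p hg
  have hX : ∀ ξ, HasFDerivAt (entireKernel ν p) (entireKernel ν p ξ • (ν : ℂ) •
      (p.1 • (Complex.conjCLE : ℂ →L[ℝ] ℂ) + p.2 • (1 : ℂ →L[ℝ] ℂ))) ξ := by
    intro ξ
    have h1 : HasFDerivAt (fun z : ℂ => z) (1 : ℂ →L[ℝ] ℂ) ξ := hasFDerivAt_id ξ
    have h2 : HasFDerivAt (fun z : ℂ => conj z) (Complex.conjCLE : ℂ →L[ℝ] ℂ) ξ :=
      Complex.conjCLE.hasFDerivAt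
    exact ((((h2.const_mul p.1).add (h1.const_mul p.2)).sub_const (p.1 * p.2)).const_mul
      (ν : ℂ)).cexp
  -- integrate by parts in each real direction `v`, then combine `v = 1` and `v = I`
  have hv : ∀ v : ℂ, ∫ ξ, entireKernel ν p ξ * fderiv ℝ f ξ v =
      -(ν * (p.1 * conj v + p.2 * v)) * ∫ ξ, entireKernel ν p ξ * f ξ := by
    intro v
    have e : ∀ ξ, fderiv ℝ (entireKernel ν p) ξ v * f ξ =
        ν * (p.1 * conj v + p.2 * v) * (entireKernel ν p ξ * f ξ) := by
      intro ξ
      rw [(hX ξ).fderiv]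
      simp
      ring
    have hf' : Integrable fun ξ => entireKernel ν p ξ * fderiv ℝ f ξ v := by
      have h := ((hi (wirtinger_mem_gaussPoly hf).1).const_mul v).add
        ((hi (wirtinger_mem_gaussPoly hf).2).const_mul (conj v))
      refine h.congr (Eventually.of_forall fun ξ => ?_)
      simp only [Pi.add_apply, fderiv_apply_eq_wirtinger]
      ring
    rw [integral_mul_fderiv_eq_neg_fderiv_mul_of_integrable (by
        simp only [e]
        exact (hi hf).const_mul _) hf' (hi hf)
      (fun ξ _ => (hX ξ).differentiableAt) (fun ξ _ => differentiable_of_mem_gaussPoly hf ξ)]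
    simp only [e]
    rw [integral_const_mul, neg_mul]
  have hw := integral_add ((hi (wirtinger_mem_gaussPoly hf).1).mul_const 1)
    ((hi (wirtinger_mem_gaussPoly hf).2).mul_const 1)
  have hw' := integral_add ((hi (wirtinger_mem_gaussPoly hf).1).mul_const Complex.I)
    ((hi (wirtinger_mem_gaussPoly hf).2).mul_const (-Complex.I))
  have h1 := hv 1
  have h2 := hv Complex.I
  simp only [fderiv_apply_eq_wirtinger, mul_add, map_one, Complex.conj_I, ← mul_assoc] at h1 h2
  rw [hw, integral_mul_const, integral_mul_const] at h1
  rw [hw', integral_mul_const, integral_mul_const] at h2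
  set W := ∫ ξ, entireKernel ν p ξ * wirtinger f ξ
  set B := ∫ ξ, entireKernel ν p ξ * wirtingerBar f ξ
  set F := ∫ ξ, entireKernel ν p ξ * f ξ
  constructor
  · linear_combination (h1 - Complex.I * h2) / 2 +
      (W - B + ν * p.2 * F - ν * p.1 * F) / 2 * Complex.I_mul_I
  · linear_combination (h1 + Complex.I * h2) / 2 -
      (W - B + ν * p.2 * F - ν * p.1 * F) / 2 * Complex.I_mul_I

theorem iterate_wirtinger_gaussPoly {ν : ℝ} (hν : 0 < ν) (p : ℂ × ℂ) {f : ℂ → ℂ}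
    (hf : f ∈ gaussPoly ν) (n : ℕ) :
    wirtinger^[n] f ∈ gaussPoly ν ∧ ∫ ξ, entireKernel ν p ξ * wirtinger^[n] f ξ =
      (-(ν * p.2)) ^ n * ∫ ξ, entireKernel ν p ξ * f ξ := by
  induction n with
  | zero => simpa using hf
  | succ n ih =>
    rw [Function.iterate_succ_apply', (integral_entireKernel_mul_wirtinger hν p ih.1).1, ih.2]
    exact ⟨(wirtinger_mem_gaussPoly ih.1).1, by ring⟩

theorem iterate_wirtingerBar_gaussPoly {ν : ℝ} (hν : 0 < ν) (p : ℂ × ℂ) {f : ℂ → ℂ}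
    (hf : f ∈ gaussPoly ν) (m : ℕ) :
    wirtingerBar^[m] f ∈ gaussPoly ν ∧ ∫ ξ, entireKernel ν p ξ * wirtingerBar^[m] f ξ =
      (-(ν * p.1)) ^ m * ∫ ξ, entireKernel ν p ξ * f ξ := by
  induction m with
  | zero => simpa using hf
  | succ m ih =>
    rw [Function.iterate_succ_apply', (integral_entireKernel_mul_wirtinger hν p ih.1).2, ih.2]
    exact ⟨(wirtinger_mem_gaussPoly ih.1).2, by ring⟩

theorem integral_entireKernel_mul_gaussian {ν : ℝ} (hν : 0 < ν) (p : ℂ × ℂ) :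
    ∫ ξ, entireKernel ν p ξ * gaussMonomial ν 0 0 ξ = (Real.pi / ν : ℝ) := by
  have e : ∀ ξ, entireKernel ν p ξ * gaussMonomial ν 0 0 ξ = Complex.exp (-ν * (‖ξ‖ : ℂ) ^ 2) *
      (Complex.exp (ν * p.1 * conj ξ) * Complex.exp (ν * (p.2 * ξ - p.1 * p.2))) := by
    intro ξ
    simp only [gaussMonomial, entireKernel, pow_zero, one_mul, ← Complex.exp_add,
      ← Complex.mul_conj', RCLike.star_def]
    ring_nf
  have hi := integrable_entireKernel_mul_of_mem_gaussPoly hν p (gaussMonomial_mem ν 0 0)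
  simp only [e] at hi ⊢
  rw [← integral_gaussC, integral_exp_mul_conj_gaussC hν
    (f := fun ξ => Complex.exp (ν * (p.2 * ξ - p.1 * p.2))) (by fun_prop) _
    ((integrable_gaussC_iff ν _).2 hi)]
  simp [mul_comm p.2 p.1]

theorem kernelT_mul_hermite (ν : ℝ) (m n : ℕ) (z w ξ : ℂ) :
    kernelT ν z w ξ * hermite ν m n ξ = (-1) ^ (m + n) * (entireKernel ν (z, w) ξ *
      wirtingerBar^[m] (wirtinger^[n] (gaussMonomial ν 0 0)) ξ) := by
  have e : (fun z : ℂ => Complex.exp (-(ν : ℂ) * z * star z)) = gaussMonomial ν 0 0 := by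
    ext ξ
    simp [gaussMonomial]
  have h : Complex.exp (-ν * (‖ξ‖ : ℂ) ^ 2) * Complex.exp (ν * ξ * star ξ) = 1 := by
    rw [← Complex.exp_add, ← Complex.mul_conj', RCLike.star_def, ← Complex.exp_zero]
    ring_nf
  rw [kernelT_eq, hermite, e]
  linear_combination (-1) ^ (m + n) * entireKernel ν (z, w) ξ *
    wirtingerBar^[m] (wirtinger^[n] (gaussMonomial ν 0 0)) ξ * h

/-- Integration by parts moves the derivatives of the Gaussian to the exponential
`exp (ν (z ξ̄ + w ξ - z w))`, which is an eigenfunction of both Wirtinger derivatives. -/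
theorem integral_kernelT_mul_hermite {ν : ℝ} (hν : 0 < ν) (m n : ℕ) (z w : ℂ) :
    Integrable (fun ξ : ℂ => kernelT ν z w ξ * hermite ν m n ξ) ∧
    ∫ ξ : ℂ, kernelT ν z w ξ * hermite ν m n ξ =
      ((Real.pi / ν : ℝ) : ℂ) * (ν : ℂ) ^ (m + n) * z ^ m * w ^ n := by
  have h0 := gaussMonomial_mem ν 0 0
  have h1 := iterate_wirtinger_gaussPoly hν (z, w) h0 n
  have h2 := iterate_wirtingerBar_gaussPoly hν (z, w) h1.1 m
  simp only at h1 h2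
  simp only [kernelT_mul_hermite]
  refine ⟨(integrable_entireKernel_mul_of_mem_gaussPoly hν _ h2.1).const_mul _, ?_⟩
  rw [integral_const_mul, h2.2, h1.2, integral_entireKernel_mul_gaussian hν]
  have hs : ((-1 : ℂ) ^ (m + n)) * (-1) ^ (m + n) = 1 := by
    rw [← mul_pow]
    simp
  rw [neg_pow ((ν : ℂ) * z), neg_pow ((ν : ℂ) * w), mul_pow, mul_pow, pow_add, pow_add]
  rw [pow_add] at hs
  linear_combination ((Real.pi / ν : ℝ) : ℂ) * (ν : ℂ) ^ m * (ν : ℂ) ^ n * z ^ m * w ^ n * hs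

end BargmannFock

end

theorem mainTheorem1 (ν : ℝ) (hν : 0 < ν) :
    (∃ U : BargmannFock.L2C ν ≃ₗᵢ[ℂ] BargmannFock.FockSpace ν,
      -- `U` is the integral operator, given by an absolutely convergent integral at every point
      (∀ (ψ : BargmannFock.L2C ν) (z w : ℂ),
        Integrable (fun ξ : ℂ => BargmannFock.kernelT ν z w ξ * ψ ξ) ∧
        U ψ (z, w) = BargmannFock.transformT ν ψ z w) ∧
      -- the inversion integral, as a limit in `L^{2,ν}(ℂ)` of integrals over balls ...
      (∀ φ : BargmannFock.FockSpace ν,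
        (∀ R : ℝ,
          (∀ ξ : ℂ, IntegrableOn (fun p => BargmannFock.kernelInv ν ξ p * φ p)
            (BargmannFock.ballC2 R)) ∧
          MemLp (BargmannFock.inverseIntegral ν (BargmannFock.ballC2 R) φ) 2
            (BargmannFock.gaussC ν)) ∧
        Tendsto (fun R : ℝ => eLpNorm
            (fun ξ => BargmannFock.inverseIntegral ν (BargmannFock.ballC2 R) φ ξ - U.symm φ ξ)
            2 (BargmannFock.gaussC ν)) atTop (𝓝 0) ∧
        -- ... and literally, at almost every point where it converges absolutely
        (∀ᵐ ξ : ℂ, Integrable (fun p => BargmannFock.kernelInv ν ξ p * φ p) →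
          U.symm φ ξ = BargmannFock.inverseIntegral ν Set.univ φ ξ))) ∧
    -- the action on the complex Hermite polynomials
    (∀ (m n : ℕ) (z w : ℂ),
      Integrable (fun ξ : ℂ => BargmannFock.kernelT ν z w ξ * BargmannFock.hermite ν m n ξ) ∧
      ∫ ξ : ℂ, BargmannFock.kernelT ν z w ξ * BargmannFock.hermite ν m n ξ =
        ((Real.pi / ν : ℝ) : ℂ) * (ν : ℂ) ^ (m + n) * z ^ m * w ^ n) := by
  refine ⟨⟨BargmannFock.transformEquiv hν, fun ψ z w => ⟨?_, rfl⟩,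
      fun φ => ⟨fun R => ⟨fun ξ => ?_, ?_⟩, ?_, ?_⟩⟩,
    BargmannFock.integral_kernelT_mul_hermite hν⟩
  · exact BargmannFock.integrable_kernelT_mul hν ψ z w
  · exact BargmannFock.integrableOn_kernelInv_mul hν φ R ξ
  · exact BargmannFock.memLp_inverseIntegral_ballC2 hν φ R
  · exact BargmannFock.tendsto_eLpNorm_inverseIntegral_sub hν φ
  · exact BargmannFock.ae_symm_eq_inverseIntegral hν φ
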